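/- All Hilbert spaces are finite-dimensional. Let $\rho_{AB}$ be a bipartite quantum state, let $k\ge 2$ be an integer and let $\varepsilon\in[0,1]$. Logarithms and differences are taken in the extended reals, with $\log_2 0=-\infty$. Definitions. A state $\sigma_{AB}$ is $k$-extendible, $\sigma_{AB}\in\operatorname{Ext}_k(A\!:\!B)$, if there is a positive semidefinite operator $\omega_{AB_1\cdots B_k}$, invariant under conjugation by all unitaries $W^\pi$ permuting $B_1,\dots,B_k$, with $\operatorname{Tr}_{B_2\cdots B_k}[\omega]=\sigma_{AB}$. Put $$D_H^\varepsilon(\rho\Vert\sigma)=-\log_2\inf_{0\le\Lambda\le I}\{\operatorname{Tr}[\Lambda\sigma]:\operatorname{Tr}[\Lambda\rho]\ge 1-\varepsilon\},\qquad E_k^\varepsilon(\rho_{AB})=\inf_{\sigma_{AB}\in\operatorname{Ext}_k(A:B)}D_H^\varepsilon(\rho_{AB}\Vert\sigma_{AB}).$$ A private state of $\log_2 d$ secret bits is a state $\gamma^d=V(\Phi^d_{A'B'}\otimes\tau_{A''B''})V^\dagger$, where $\Phi^d=\frac1d\sum_{i,j}|i\rangle\langle j|\otimes|i\rangle\langle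 j|$, $\tau$ is a state, and $V=\sum_i I_{A'}\otimes|i\rangle\langle i|_{B'}\otimes U^i_{A''B''}$ with unitaries $U^i$. A one-way LOCC channel is a map $\sum_x\mathcal E^x\otimes\mathcal F^x$ (finite sum, $\mathcal{E}^x$ acting on Alice's side, $\mathcal{F}^x$ on Bob's) with $\mathcal E^x$ completely positive, $\sum_x\mathcal E^x$ trace preserving, and each $\mathcal F^x$ a quantum channel. With $F(\rho,\sigma)=(\operatorname{Tr}\sqrt{\sqrt\sigma\rho\sqrt\sigma})^2$, the one-shot, one-way distillable key $K^{\varepsilon,\to}(\rho_{AB})$ is the supremum of $\log_2 d$ over all integers $d\ge1$ for which there exist a one-way LOCC channel $\mathcal L$ from $A:B$ to $A'A'':B'B''$ and a private state $\gamma^d_{A'B'A''B''}$ with $F(\mathcal L(\rho_{AB}),\gamma^d)\ge1-\varepsilon$. Theorem. (1) If $E_k^\varepsilon(\rho_{AB})\le\log_2 k$, then $$K^{\varepsilon,\to}(\rho_{AB})\le\log_2\!\left(\frac{k-1}{k}\right)-\log_2\!\left(2^{-E_k^\varepsilon(\rho_{AB})}-\frac1k\right).$$ (2) The bound is computable by a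 semidefinite program: $E_k^\varepsilon(\rho_{AB})=-\log_2 v$, where $v\ge 0$ is the optimal value of the semidefinite program $$v=\sup\left\{\mu(1-\varepsilon)-\operatorname{Tr}[Z_{AB}]:\ \begin{array}{l}\mu\ge0,\ Z_{AB}\ge0,\ \omega_{AB_1\cdots B_k}\ge0,\ \operatorname{Tr}[\omega]=1,\\ \mu\rho_{AB}\le\operatorname{Tr}_{B_2\cdots B_k}[\omega]+Z_{AB},\\ W^\pi\omega (W^{\pi})^\dagger=\omega\ \text{ for all }\pi\in S_k\end{array}\right\},$$ and the supremum is attained if $\varepsilon>0$. -/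

import Mathlib

open scoped ENNReal ComplexOrder MatrixOrder Kronecker

noncomputable section

namespace OneWayKey

/-! Finite-dimensional systems are modelled by finite index types (a fixed orthonormal basis of
the Hilbert space); operators on a system are complex square matrices, and the system `AB` has
the index type `A × B`. On matrices, `X ≤ Y` is the Loewner order. -/

/-- Base-two logarithm `[0, ∞] → [-∞, ∞]`, with `log₂ 0 = -∞` and `log₂ ∞ = ∞`. -/
def log2 (x : ℝ≥0∞) : EReal := x.log / ((Real.log 2 : ℝ) : EReal)

/-- Base-two exponential `2 ^ y : [-∞, ∞] → [0, ∞]`. -/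
def exp2 (y : EReal) : ℝ≥0∞ := (y * ((Real.log 2 : ℝ) : EReal)).exp

/-- Quantum states: positive semidefinite operators of unit trace. -/
def IsState {A : Type*} [Fintype A] (ρ : Matrix A A ℂ) : Prop :=
  ρ.PosSemidef ∧ ρ.trace = 1

/-! ### Channels -/

/-- The tensor product `𝓔 ⊗ 𝓕` of two linear maps on matrices: `𝓕` is applied to the
`B`-blocks of `X`, then `𝓔` to the `A`-part of the result. -/
def tensorMap {A A' B B' : Type*}
    (𝓔 : Matrix A A ℂ →ₗ[ℂ] Matrix A' A' ℂ) (𝓕 : Matrix B B ℂ →ₗ[ℂ] Matrix B' B' ℂ) :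
    Matrix (A × B) (A × B) ℂ →ₗ[ℂ] Matrix (A' × B') (A' × B') ℂ where
  toFun X := Matrix.of fun x y =>
    𝓔 (Matrix.of fun i j => 𝓕 (Matrix.of fun p q => X (i, p) (j, q)) x.2 y.2) x.1 y.1
  map_add' X Y := by
    ext x y
    refine Eq.trans ?_ (congrFun (congrFun (𝓔.map_add _ _) x.1) y.1)
    refine congrArg (fun M => 𝓔 M x.1 y.1) ?_
    ext i j
    exact congrFun (congrFun (𝓕.map_add (Matrix.of fun p q => X (i, p) (j, q))
      (Matrix.of fun p q => Y (i, p) (j, q))) x.2) y.2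
  map_smul' c X := by
    ext x y
    refine Eq.trans ?_ (congrFun (congrFun (𝓔.map_smul c _) x.1) y.1)
    refine congrArg (fun M => 𝓔 M x.1 y.1) ?_
    ext i j
    exact congrFun (congrFun (𝓕.map_smul c (Matrix.of fun p q => X (i, p) (j, q))) x.2) y.2

/-- Complete positivity: `id_n ⊗ 𝓔` preserves positive semidefiniteness for every `n`. -/
def IsCP {A A' : Type*} (𝓔 : Matrix A A ℂ →ₗ[ℂ] Matrix A' A' ℂ) : Prop :=
  ∀ (n : ℕ) (X : Matrix (Fin n × A) (Fin n × A) ℂ), X.PosSemidef →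
    (tensorMap (LinearMap.id : Matrix (Fin n) (Fin n) ℂ →ₗ[ℂ] Matrix (Fin n) (Fin n) ℂ) 𝓔
      X).PosSemidef

/-- Trace preservation. -/
def IsTP {A A' : Type*} [Fintype A] [Fintype A']
    (𝓔 : Matrix A A ℂ →ₗ[ℂ] Matrix A' A' ℂ) : Prop :=
  ∀ X, (𝓔 X).trace = X.trace

/-- Quantum channels: completely positive trace-preserving maps. -/
def IsChannel {A A' : Type*} [Fintype A] [Fintype A']
    (𝓔 : Matrix A A ℂ →ₗ[ℂ] Matrix A' A' ℂ) : Prop :=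
  IsCP 𝓔 ∧ IsTP 𝓔

/-- One-way (Alice to Bob) LOCC channels `∑ₓ 𝓔ˣ ⊗ 𝓕ˣ`, where the `𝓔ˣ` are completely positive
maps that sum to a channel and every `𝓕ˣ` is a channel. -/
def IsOneWayLOCC {A A' B B' : Type*} [Fintype A] [Fintype A'] [Fintype B] [Fintype B']
    (𝓛 : Matrix (A × B) (A × B) ℂ →ₗ[ℂ] Matrix (A' × B') (A' × B') ℂ) : Prop :=
  ∃ (N : ℕ) (𝓔 : Fin N → (Matrix A A ℂ →ₗ[ℂ] Matrix A' A' ℂ))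
    (𝓕 : Fin N → (Matrix B B ℂ →ₗ[ℂ] Matrix B' B' ℂ)),
    (∀ x, IsCP (𝓔 x)) ∧ IsChannel (∑ x, 𝓔 x) ∧ (∀ x, IsChannel (𝓕 x)) ∧
      𝓛 = ∑ x, tensorMap (𝓔 x) (𝓕 x)

/-! ### Private states, fidelity, distillable key -/

/-- The maximally entangled state `Φᵈ = (1/d) ∑ᵢⱼ |i⟩⟨j| ⊗ |i⟩⟨j|`. -/
def maxEntangled (d : ℕ) : Matrix (Fin d × Fin d) (Fin d × Fin d) ℂ :=
  (1 / (d : ℂ)) • ∑ i : Fin d, ∑ j : Fin d, Matrix.single i j 1 ⊗ₖ Matrix.single i j 1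

/-- The twisting unitary `V = ∑ᵢ I_A ⊗ |i⟩⟨i|_B ⊗ Uⁱ_{A'B'}`, in the tensor order `(AB)(A'B')`. -/
def twist {d : ℕ} {S T : Type*} [Fintype S] [DecidableEq S] [Fintype T] [DecidableEq T]
    (U : Fin d → Matrix.unitaryGroup (S × T) ℂ) :
    Matrix ((Fin d × Fin d) × (S × T)) ((Fin d × Fin d) × (S × T)) ℂ :=
  ∑ i : Fin d,
    ((1 : Matrix (Fin d) (Fin d) ℂ) ⊗ₖ Matrix.single i i 1) ⊗ₖ (U i : Matrix (S × T) (S × T) ℂ)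

/-- Private states of `log₂ d` secret bits with shield systems `S` (Alice) and `T` (Bob):
`V (Φᵈ ⊗ τ) V†` for a twisting unitary `V` and a state `τ` of the shield. -/
def IsPrivateState {d : ℕ} {S T : Type*} [Fintype S] [DecidableEq S] [Fintype T] [DecidableEq T]
    (γ : Matrix ((Fin d × Fin d) × (S × T)) ((Fin d × Fin d) × (S × T)) ℂ) : Prop :=
  ∃ (U : Fin d → Matrix.unitaryGroup (S × T) ℂ) (τ : Matrix (S × T) (S × T) ℂ), IsState τ ∧
    γ = twist U * (maxEntangled d ⊗ₖ τ) * (twist U).conjTranspose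

/-- The fidelity `F(ρ, σ) = (Tr √(√σ ρ √σ))²`. -/
def fidelity {A : Type*} [Fintype A] [DecidableEq A] (ρ σ : Matrix A A ℂ) : ℝ :=
  ((CFC.sqrt (CFC.sqrt σ * ρ * CFC.sqrt σ)).trace.re) ^ 2

/-- Regrouping of an operator from the order `(A S)(B T)`, in which Alice and Bob hold their key
and shield systems, to the order `(A B)(S T)`. -/
def regroup {K S L T : Type*} (X : Matrix ((K × S) × (L × T)) ((K × S) × (L × T)) ℂ) :
    Matrix ((K × L) × (S × T)) ((K × L) × (S × T)) ℂ :=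
  X.submatrix (Equiv.prodProdProdComm K L S T) (Equiv.prodProdProdComm K L S T)

/-- Some one-way LOCC channel takes `ρ` to within fidelity `1 - ε` of some private state of
`log₂ d` secret bits. -/
def Distillable {A B : Type*} [Fintype A] [Fintype B]
    (ρ : Matrix (A × B) (A × B) ℂ) (ε : ℝ) (d : ℕ) : Prop :=
  ∃ (s t : ℕ) (γ : Matrix ((Fin d × Fin d) × (Fin s × Fin t))
      ((Fin d × Fin d) × (Fin s × Fin t)) ℂ)
    (𝓛 : Matrix (A × B) (A × B) ℂ →ₗ[ℂ]
      Matrix ((Fin d × Fin s) × (Fin d × Fin t)) ((Fin d × Fin s) × (Fin d × Fin t)) ℂ),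
    IsPrivateState γ ∧ IsOneWayLOCC 𝓛 ∧ 1 - ε ≤ fidelity (regroup (𝓛 ρ)) γ

/-- The one-shot, one-way distillable key `K^{ε,→}(ρ_AB)`. -/
def distillableKey {A B : Type*} [Fintype A] [Fintype B]
    (ρ : Matrix (A × B) (A × B) ℂ) (ε : ℝ) : EReal :=
  ⨆ d ∈ {d : ℕ | 1 ≤ d ∧ Distillable ρ ε d}, log2 (d : ℝ≥0∞)

/-! ### Extendibility -/

/-- The partial trace over all `B`-systems except the `i`-th, of an operator on `A B₁ ⋯ B_k`. -/
def marginal {A B : Type*} [Fintype B] {k : ℕ} (i : Fin k)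
    (ω : Matrix (A × (Fin k → B)) (A × (Fin k → B)) ℂ) : Matrix (A × B) (A × B) ℂ :=
  Matrix.of fun x y => ∑ h : {j // j ≠ i} → B,
    ω (x.1, (Equiv.funSplitAt i B).symm (x.2, h)) (y.1, (Equiv.funSplitAt i B).symm (y.2, h))

/-- Invariance under all permutations of the `B`-systems. Conjugation by the unitary
`|a⟩|b₁ ⋯ b_k⟩ ↦ |a⟩|b_{π⁻¹(1)} ⋯ b_{π⁻¹(k)}⟩` reindexes rows and columns by `b ↦ b ∘ π`. -/
def PermInvariant {A B : Type*} {k : ℕ}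
    (ω : Matrix (A × (Fin k → B)) (A × (Fin k → B)) ℂ) : Prop :=
  ∀ π : Equiv.Perm (Fin k),
    ω.submatrix (Prod.map id fun b => b ∘ π) (Prod.map id fun b => b ∘ π) = ω

/-- The set `Ext_k(A:B)` of `k`-extendible states. -/
def Ext {A B : Type*} [Fintype A] [Fintype B] (k : ℕ) : Set (Matrix (A × B) (A × B) ℂ) :=
  {σ | IsState σ ∧ ∃ (hk : 0 < k) (ω : Matrix (A × (Fin k → B)) (A × (Fin k → B)) ℂ),
    ω.PosSemidef ∧ marginal ⟨0, hk⟩ ω = σ ∧ PermInvariant ω}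

/-! ### Hypothesis testing -/

/-- The hypothesis-testing relative entropy
`D_H^ε(ρ‖σ) = -log₂ inf {Tr[Λσ] : 0 ≤ Λ ≤ I, Tr[Λρ] ≥ 1 - ε}`. -/
def hypTestEntropy {A : Type*} [Fintype A] [DecidableEq A] (ε : ℝ) (ρ σ : Matrix A A ℂ) : EReal :=
  -log2 (⨅ Λ ∈ {Λ : Matrix A A ℂ | 0 ≤ Λ ∧ Λ ≤ 1 ∧ 1 - ε ≤ (Λ * ρ).trace.re},
    ENNReal.ofReal (Λ * σ).trace.re)

/-- The `k`-unextendible hypothesis-testing divergence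
`E_k^ε(ρ_AB) = inf {D_H^ε(ρ‖σ) : σ ∈ Ext_k(A:B)}`. -/
def unextDivergence {A B : Type*} [Fintype A] [DecidableEq A] [Fintype B] [DecidableEq B]
    (k : ℕ) (ε : ℝ) (ρ : Matrix (A × B) (A × B) ℂ) : EReal :=
  ⨅ σ ∈ (Ext k : Set (Matrix (A × B) (A × B) ℂ)), hypTestEntropy ε ρ σ

/-- The objective values `μ(1-ε) - Tr Z` at the feasible points `(μ, Z, ω)` of the semidefinite
program with the constraints `μ ≥ 0`, `Z_AB ≥ 0`, `ω_{A B₁⋯B_k} ≥ 0`,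
`μ ρ ≤ Tr_{B₂⋯B_k} ω + Z`, `ω` permutation invariant, `Tr ω = 1`. -/
def sdpValues {A B : Type*} [Fintype A] [Fintype B]
    (k : ℕ) (ε : ℝ) (ρ : Matrix (A × B) (A × B) ℂ) : Set ℝ :=
  {v | ∃ (hk : 0 < k) (μ : ℝ) (Z : Matrix (A × B) (A × B) ℂ)
      (ω : Matrix (A × (Fin k → B)) (A × (Fin k → B)) ℂ),
    0 ≤ μ ∧ 0 ≤ Z ∧ 0 ≤ ω ∧ (μ : ℂ) • ρ ≤ marginal ⟨0, hk⟩ ω + Z ∧ PermInvariant ω ∧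
      ω.trace = 1 ∧ v = μ * (1 - ε) - Z.trace.re}

end OneWayKey

end

namespace OneWayKey

open Matrix

/-! ### Positive semidefinite matrices -/

section PosSemidef

variable {n m : Type*} [Fintype n] [Fintype m]

/-! Part (1). A key protocol is also a test: run it, then project onto V(Φᵈ ⊗ I)V†. Pulled back
through the channel, this projection is an operator 0 ≤ Λ ≤ 1 on AB. Fidelity with a state is at
most the weight on a projection containing its support (`fidelity_le_re_trace`), so ρ passes with
probability at least 1 - ε. A k-extendible σ passes rarely, by monogamy. The privacy projections P_i
of Alice with the i-th extension satisfy P_i P_j P_i = d⁻² P_i for i ≠ j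
(`twistedRow_mul_star_mul`), hence sum to at most 1 + (k-1)/d (`posSemidef_smul_one_sub_sum`). The
bound survives the protocol because a one-way message can be handed to all k extensions, each of
which applies Bob's channel, dilated to an isometry (`posSemidef_sub_sum_localOp_conj`). By
permutation invariance all extensions pass with the same probability, so Tr[Λσ] ≤ 1/k + 1/d - 1/(kd)
(`Distillable.exists_test`). Taking σ optimal for the divergence and solving for d gives the bound.
Part (2). For fixed σ the least type-II error is a semidefinite program in Λ, with dual objective
μ(1-ε) - Tr Z under μρ ≤ σ + Z. Maximizing also over the extension ω of σ gives the stated program.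
Strong duality is a separation argument in the plane (`test_strong_duality`) that needs ε > 0; the
value at ε = 0 follows from a limit and compactness of the tests (`unextDivergence_sdp`). -/

lemma exists_eq_conjTranspose_mul_self {X : Matrix n n ℂ} (hX : X.PosSemidef) :
    ∃ Y : Matrix n n ℂ, X = Yᴴ * Y := by
  classical
  exact CStarAlgebra.nonneg_iff_eq_star_mul_self.mp hX.nonneg

lemma re_trace_nonneg {X : Matrix n n ℂ} (hX : X.PosSemidef) : 0 ≤ X.trace.re :=
  (Complex.nonneg_iff.mp hX.trace_nonneg).1

lemma re_trace_mul_nonneg {X Y : Matrix n n ℂ} (hX : X.PosSemidef) (hY : Y.PosSemidef) :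
    0 ≤ (X * Y).trace.re := by
  obtain ⟨Z, rfl⟩ := exists_eq_conjTranspose_mul_self hX
  rw [mul_assoc, trace_mul_comm]
  exact re_trace_nonneg (hY.mul_mul_conjTranspose_same Z)

/-- Entries of Yᴴ * Y are inner products of columns of Y, and the trace is the sum of the squared
column norms. This turns a trace bound into boundedness, the source of compactness for tests and for
extensions. -/
lemma norm_apply_le_re_trace {X : Matrix n n ℂ} (hX : X.PosSemidef) (i j : n) :
    ‖X i j‖ ≤ X.trace.re := by
  obtain ⟨Y, rfl⟩ := exists_eq_conjTranspose_mul_self hX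
  have htr : (Yᴴ * Y).trace.re = ∑ l, ∑ p, ‖Y p l‖ ^ 2 := by
    simp only [trace, diag_apply, mul_apply, conjTranspose_apply, Complex.re_sum]
    refine Finset.sum_congr rfl fun l _ => Finset.sum_congr rfl fun p _ => ?_
    simp [← Complex.normSq_eq_norm_sq, Complex.normSq_apply]
  have hle : ∀ l, ∑ p, ‖Y p l‖ ^ 2 ≤ (Yᴴ * Y).trace.re := fun l => by
    rw [htr]
    exact Finset.single_le_sum (f := fun l => ∑ p, ‖Y p l‖ ^ 2)
      (fun l _ => Finset.sum_nonneg fun p _ => by positivity) (Finset.mem_univ l)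
  calc ‖(Yᴴ * Y) i j‖ ≤ ∑ p, ‖Y p i‖ * ‖Y p j‖ := by
        rw [mul_apply]
        refine (norm_sum_le _ _).trans (Finset.sum_le_sum fun p _ => ?_)
        simp
    _ ≤ ∑ p, (‖Y p i‖ ^ 2 + ‖Y p j‖ ^ 2) / 2 :=
        Finset.sum_le_sum fun p _ => by nlinarith [sq_nonneg (‖Y p i‖ - ‖Y p j‖)]
    _ = (∑ p, ‖Y p i‖ ^ 2 + ∑ p, ‖Y p j‖ ^ 2) / 2 := by
        rw [← Finset.sum_div, Finset.sum_add_distrib]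
    _ ≤ _ := by linarith [hle i, hle j]

lemma isClosed_posSemidef : IsClosed {X : Matrix n n ℂ | X.PosSemidef} := by
  have : {X : Matrix n n ℂ | X.PosSemidef} =
      {X | Xᴴ = X} ∩ ⋂ x : n → ℂ, {X | 0 ≤ star x ⬝ᵥ (X *ᵥ x)} := by
    ext X
    simp [posSemidef_iff_dotProduct_mulVec, IsHermitian]
  rw [this]
  refine (isClosed_eq (by fun_prop) continuous_id).inter (isClosed_iInter fun x => ?_)
  have hc : Continuous fun X : Matrix n n ℂ => star x ⬝ᵥ (X *ᵥ x) :=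
    Continuous.dotProduct continuous_const (Continuous.matrix_mulVec continuous_id continuous_const)
  have hset : {X : Matrix n n ℂ | 0 ≤ star x ⬝ᵥ (X *ᵥ x)} =
      {X | 0 ≤ (star x ⬝ᵥ (X *ᵥ x)).re} ∩ {X | 0 = (star x ⬝ᵥ (X *ᵥ x)).im} := by
    ext X
    simp [Complex.nonneg_iff]
  rw [hset]
  exact (isClosed_le continuous_const (Complex.continuous_re.comp hc)).inter
    (isClosed_eq continuous_const (Complex.continuous_im.comp hc))

lemma isCompact_posSemidef_re_trace_le (c : ℝ) :
    IsCompact {X : Matrix n n ℂ | X.PosSemidef ∧ X.trace.re ≤ c} := by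
  have hK : IsCompact (Set.univ.pi fun _ : n => Set.univ.pi fun _ : n =>
      Metric.closedBall (0 : ℂ) c) :=
    isCompact_univ_pi fun _ => isCompact_univ_pi fun _ => isCompact_closedBall _ _
  refine IsCompact.of_isClosed_subset (X := Matrix n n ℂ) hK ?_ ?_
  · have : IsClosed {X : Matrix n n ℂ | X.trace.re ≤ c} :=
      isClosed_le (Complex.continuous_re.comp (Continuous.matrix_trace continuous_id))
        continuous_const
    exact isClosed_posSemidef.inter this
  · rintro X ⟨hX, hc⟩ i - j -
    simpa using (norm_apply_le_re_trace hX i j).trans hc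

lemma exists_unitary_diagonal [DecidableEq n] {H : Matrix n n ℂ} (hH : H.IsHermitian) :
    ∃ (U : Matrix n n ℂ) (d : n → ℝ), Uᴴ * U = 1 ∧ U * Uᴴ = 1 ∧
      H = U * diagonal (fun i => (d i : ℂ)) * Uᴴ := by
  refine ⟨hH.eigenvectorUnitary, hH.eigenvalues, ?_, ?_, ?_⟩
  · exact Unitary.coe_star_mul_self hH.eigenvectorUnitary
  · exact Unitary.coe_mul_star_self hH.eigenvectorUnitary
  · exact hH.spectral_theorem

lemma conj_diagonal_mul [DecidableEq n] {U : Matrix n n ℂ} (hU : Uᴴ * U = 1) (d e : n → ℂ) :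
    (U * diagonal d * Uᴴ) * (U * diagonal e * Uᴴ) = U * diagonal (fun i => d i * e i) * Uᴴ := by
  calc _ = U * diagonal d * (Uᴴ * U) * diagonal e * Uᴴ := by simp only [mul_assoc]
    _ = _ := by rw [hU, mul_one, mul_assoc U, diagonal_mul_diagonal]

lemma posSemidef_conj_diagonal [DecidableEq n] (U : Matrix n n ℂ) {d : n → ℝ} (hd : ∀ i, 0 ≤ d i) :
    (U * diagonal (fun i => (d i : ℂ)) * Uᴴ).PosSemidef :=
  (PosSemidef.diagonal fun i => by simpa using hd i).mul_mul_conjTranspose_same U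

/-- The positive part `Z` of a Hermitian `H` and the projection `Λ` onto its support. -/
lemma exists_posPart [DecidableEq n] {H : Matrix n n ℂ} (hH : H.IsHermitian) :
    ∃ Z Λ : Matrix n n ℂ, 0 ≤ Z ∧ H ≤ Z ∧ 0 ≤ Λ ∧ Λ ≤ 1 ∧ Λ * H = Z := by
  obtain ⟨U, d, hU, hU', rfl⟩ := exists_unitary_diagonal hH
  refine ⟨U * diagonal (fun i => ((max (d i) 0 : ℝ) : ℂ)) * Uᴴ,
    U * diagonal (fun i => ((if 0 < d i then 1 else 0 : ℝ) : ℂ)) * Uᴴ, ?_, ?_, ?_, ?_, ?_⟩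
  · exact (posSemidef_conj_diagonal U fun i => le_max_right _ _).nonneg
  · rw [le_iff, ← sub_mul, ← mul_sub, diagonal_sub]
    simp_rw [← Complex.ofReal_sub]
    exact posSemidef_conj_diagonal U fun i => sub_nonneg.mpr (le_max_left _ _)
  · exact (posSemidef_conj_diagonal U fun i => by split_ifs <;> norm_num).nonneg
  · rw [le_iff]
    have h1 : (1 : Matrix n n ℂ) = U * diagonal (fun _ => ((1 : ℝ) : ℂ)) * Uᴴ := by simp [hU']
    nth_rewrite 1 [h1]
    rw [← sub_mul, ← mul_sub, diagonal_sub]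
    simp_rw [← Complex.ofReal_sub]
    exact posSemidef_conj_diagonal U fun i => by split_ifs <;> norm_num
  · rw [conj_diagonal_mul hU]
    congr 3
    ext i
    rw [← Complex.ofReal_mul]
    congr 1
    split_ifs with h
    · rw [one_mul, max_eq_left h.le]
    · rw [zero_mul, max_eq_right (not_lt.mp h)]

/-- The Moore–Penrose inverse of a Hermitian matrix. -/
lemma exists_pseudoinverse {S : Matrix n n ℂ} (hS : S.IsHermitian) :
    ∃ P : Matrix n n ℂ, P.IsHermitian ∧ S * P * S = S ∧ P * S * P = P ∧ P * S = S * P := by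
  classical
  obtain ⟨U, d, hU, hU', rfl⟩ := exists_unitary_diagonal hS
  refine ⟨U * diagonal (fun i => (((d i)⁻¹ : ℝ) : ℂ)) * Uᴴ, ?_, ?_, ?_, ?_⟩
  · have : (diagonal (fun i => (((d i)⁻¹ : ℝ) : ℂ))).IsHermitian := by
      rw [isHermitian_diagonal_iff]
      exact fun i => Complex.conj_ofReal _
    exact isHermitian_mul_mul_conjTranspose U this
  all_goals simp only [conj_diagonal_mul hU]; congr 3; ext i
  · simp
  · rcases eq_or_ne (d i) 0 with h | h <;> simp [h]
  · rw [mul_comm]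

/-- Cauchy–Schwarz for the Hilbert–Schmidt inner product: the quadratic t ↦ Tr (tX+Y)ᴴ(tX+Y) is
nonnegative, so its discriminant is not positive. -/
lemma re_trace_conjTranspose_mul_sq_le (X Y : Matrix m n ℂ) :
    ((Xᴴ * Y).trace.re) ^ 2 ≤ (Xᴴ * X).trace.re * (Yᴴ * Y).trace.re := by
  have hsymm : (Yᴴ * X).trace.re = (Xᴴ * Y).trace.re := by
    have := congrArg Complex.re (trace_conjTranspose (Xᴴ * Y))
    simpa using this
  have h : ∀ t : ℝ, 0 ≤ (Xᴴ * X).trace.re * (t * t) + 2 * (Xᴴ * Y).trace.re * t +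
      (Yᴴ * Y).trace.re := fun t => by
    have := re_trace_nonneg (posSemidef_conjTranspose_mul_self ((t : ℂ) • X + Y))
    simp only [conjTranspose_add, conjTranspose_smul, Matrix.add_mul, Matrix.mul_add, trace_add,
      Matrix.smul_mul, Matrix.mul_smul, trace_smul, smul_eq_mul, Complex.add_re, RCLike.star_def, Complex.conj_ofReal,
      Complex.re_ofReal_mul, hsymm] at this
    linarith
  have := discrim_le_zero h
  rw [discrim] at this
  linarith

end PosSemidef

/-! ### Duality for hypothesis tests -/

section Duality

variable {n : Type*} [Fintype n]

lemma continuous_re_trace_mul_right (σ : Matrix n n ℂ) :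
    Continuous fun Λ : Matrix n n ℂ => (Λ * σ).trace.re :=
  Complex.continuous_re.comp ((continuous_id.matrix_mul continuous_const).matrix_trace)

lemma continuous_re_trace_mul_left (Λ : Matrix n n ℂ) :
    Continuous fun σ : Matrix n n ℂ => (Λ * σ).trace.re :=
  Complex.continuous_re.comp ((continuous_const.matrix_mul continuous_id).matrix_trace)

lemma isCompact_tests [DecidableEq n] : IsCompact {Λ : Matrix n n ℂ | 0 ≤ Λ ∧ Λ ≤ 1} := by
  refine (isCompact_posSemidef_re_trace_le (Fintype.card n)).of_isClosed_subset ?_ ?_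
  · have h0 : IsClosed {Λ : Matrix n n ℂ | 0 ≤ Λ} := by
      simpa only [nonneg_iff_posSemidef] using isClosed_posSemidef
    have h1 : IsClosed {Λ : Matrix n n ℂ | Λ ≤ 1} :=
      isClosed_posSemidef.preimage (continuous_const.sub continuous_id)
    exact h0.inter h1
  · rintro Λ ⟨h0, h1⟩
    refine ⟨nonneg_iff_posSemidef.mp h0, ?_⟩
    have := re_trace_nonneg (le_iff.mp h1)
    simpa using this

lemma re_trace_mul_mono {Λ X Y : Matrix n n ℂ} (hΛ : 0 ≤ Λ) (h : X ≤ Y) :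
    (Λ * X).trace.re ≤ (Λ * Y).trace.re := by
  have := re_trace_mul_nonneg (nonneg_iff_posSemidef.mp hΛ) (le_iff.mp h)
  simpa [Matrix.mul_sub] using this

lemma re_trace_mul_le [DecidableEq n] {Λ X : Matrix n n ℂ} (hΛ : Λ ≤ 1) (h : 0 ≤ X) :
    (Λ * X).trace.re ≤ X.trace.re := by
  have := re_trace_mul_nonneg (le_iff.mp hΛ) (nonneg_iff_posSemidef.mp h)
  simpa [Matrix.sub_mul] using this

/-- Pair the dual constraint with Λ ≥ 0, and use Tr[ΛZ] ≤ Tr Z, which follows from Λ ≤ 1. -/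
lemma test_weak_duality [DecidableEq n] {ρ σ Z Λ : Matrix n n ℂ} {μ ε : ℝ} (hμ : 0 ≤ μ)
    (hZ : 0 ≤ Z) (h : (μ : ℂ) • ρ ≤ σ + Z) (hΛ : 0 ≤ Λ) (hΛ' : Λ ≤ 1)
    (hρ : 1 - ε ≤ (Λ * ρ).trace.re) : μ * (1 - ε) - Z.trace.re ≤ (Λ * σ).trace.re := by
  have h1 := re_trace_mul_mono hΛ h
  have h2 := re_trace_mul_le hΛ' hZ
  have h3 := mul_le_mul_of_nonneg_left hρ hμ
  simp only [Matrix.mul_smul, trace_smul, Matrix.mul_add, trace_add, Complex.add_re, smul_eq_mul,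
    Complex.re_ofReal_mul] at h1
  linarith

/-- A line in the plane separates (1-ε, β) from the pairs dominated by tests, and its slope is the
multiplier μ. The best Z for this μ is the positive part of μρ - σ; evaluating the separating
functional at the projection onto the support of Z, a Neyman–Pearson test, gives the dual
inequality. -/
lemma test_strong_duality [DecidableEq n] {ρ σ : Matrix n n ℂ} {β ε : ℝ} (hρ : IsState ρ)
    (hσ : IsState σ) (hε : 0 < ε)
    (hβ : ∀ Λ : Matrix n n ℂ, 0 ≤ Λ → Λ ≤ 1 → 1 - ε ≤ (Λ * ρ).trace.re → β ≤ (Λ * σ).trace.re) :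
    ∃ (μ : ℝ) (Z : Matrix n n ℂ), 0 ≤ μ ∧ 0 ≤ Z ∧ (μ : ℂ) • ρ ≤ σ + Z ∧
      β ≤ μ * (1 - ε) - Z.trace.re := by
  -- Strict domination makes `C` open, so it can be separated from a point merely outside it.
  let C : Set (ℝ × ℝ) :=
    {p | ∃ Λ : Matrix n n ℂ, (0 ≤ Λ ∧ Λ ≤ 1) ∧ p.1 < (Λ * ρ).trace.re ∧ (Λ * σ).trace.re < p.2}
  have hCo : IsOpen C := by
    have : C = ⋃ Λ ∈ {Λ : Matrix n n ℂ | 0 ≤ Λ ∧ Λ ≤ 1},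
        {p : ℝ × ℝ | p.1 < (Λ * ρ).trace.re ∧ (Λ * σ).trace.re < p.2} := by
      ext p
      simp only [C, Set.mem_iUnion, Set.mem_ofPred_eq, exists_prop]
    rw [this]
    exact isOpen_biUnion fun Λ _ => (isOpen_lt continuous_fst continuous_const).inter
      (isOpen_lt continuous_const continuous_snd)
  have hCc : Convex ℝ C := by
    rintro p ⟨Λ, ⟨h0, h1⟩, hp1, hp2⟩ q ⟨Γ, ⟨h0', h1'⟩, hq1, hq2⟩ a b ha hb hab
    refine ⟨(a : ℂ) • Λ + (b : ℂ) • Γ, ⟨?_, ?_⟩, ?_, ?_⟩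
    · rw [nonneg_iff_posSemidef] at *
      exact (h0.smul (Complex.zero_le_real.mpr ha)).add (h0'.smul (Complex.zero_le_real.mpr hb))
    · rw [le_iff] at *
      have := (h1.smul (Complex.zero_le_real.mpr ha)).add (h1'.smul (Complex.zero_le_real.mpr hb))
      convert this using 1
      have hab' : (a : ℂ) + b = 1 := by exact_mod_cast hab
      have h1 : (1 : Matrix n n ℂ) = (a : ℂ) • 1 + (b : ℂ) • 1 := by rw [← add_smul, hab', one_smul]
      rw [smul_sub, smul_sub]
      nth_rewrite 1 [h1]
      abel
    all_goals
      simp only [Matrix.add_mul, Matrix.smul_mul, trace_add, trace_smul, smul_eq_mul,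
        Complex.add_re, Complex.re_ofReal_mul, Prod.fst_add, Prod.snd_add, Prod.smul_fst,
        Prod.smul_snd]
      rcases ha.eq_or_lt with rfl | ha'
      · obtain rfl : b = 1 := by linarith
        linarith
      · nlinarith
  have hmem : ((1 - ε, β) : ℝ × ℝ) ∉ C := by
    rintro ⟨Λ, ⟨h0, h1⟩, h2, h3⟩
    exact (hβ Λ h0 h1 h2.le).not_gt h3
  obtain ⟨f, hf⟩ := geometric_hahn_banach_open_point hCc hCo hmem
  obtain ⟨a, b, hab⟩ : ∃ a b : ℝ, ∀ x y : ℝ, f (x, y) = a * x + b * y := by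
    refine ⟨f (1, 0), f (0, 1), fun x y => ?_⟩
    have : ((x, y) : ℝ × ℝ) = x • (1, 0) + y • (0, 1) := by simp
    rw [this, map_add, map_smul, map_smul, smul_eq_mul, smul_eq_mul, mul_comm, mul_comm y]
  have hlt : ∀ Λ : Matrix n n ℂ, 0 ≤ Λ → Λ ≤ 1 → ∀ s > 0, ∀ t > 0,
      a * ((Λ * ρ).trace.re - s) + b * ((Λ * σ).trace.re + t) < a * (1 - ε) + b * β :=
    fun Λ h0 h1 s hs t ht => by
      rw [← hab, ← hab]
      exact hf _ ⟨Λ, ⟨h0, h1⟩, by simpa using hs, by simpa using ht⟩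
  -- Let the slacks s and t in `hlt` tend to 0; the summand 1 in the denominator covers a = b = 0.
  have hle : ∀ Λ : Matrix n n ℂ, 0 ≤ Λ → Λ ≤ 1 →
      a * (Λ * ρ).trace.re + b * (Λ * σ).trace.re ≤ a * (1 - ε) + b * β := fun Λ h0 h1 => by
    refine le_of_forall_pos_le_add fun δ hδ => ?_
    have hpos : 0 < |a| + |b| + 1 := by positivity
    have h := hlt Λ h0 h1 (δ / (|a| + |b| + 1)) (by positivity) (δ / (|a| + |b| + 1)) (by positivity)
    have hs : (|a| + |b|) * (δ / (|a| + |b| + 1)) ≤ δ := by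
      rw [← mul_div_assoc, div_le_iff₀ hpos]
      nlinarith
    have hs0 : 0 < δ / (|a| + |b| + 1) := by positivity
    nlinarith [le_abs_self a, neg_abs_le b]
  have h1 : (1 : Matrix n n ℂ) ≤ 1 := le_rfl
  have h0 : (0 : Matrix n n ℂ) ≤ 1 := nonneg_iff_posSemidef.mpr PosSemidef.one
  have hone : ∀ s > 0, ∀ t > 0, a * (1 - s) + b * (1 + t) < a * (1 - ε) + b * β := by
    simpa [hρ.2, hσ.2] using hlt 1 h0 h1
  -- `C` is unbounded below in its first coordinate, so a negative slope a would make the functional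
  -- unbounded on it.
  have ha : 0 ≤ a := by
    by_contra! ha
    have hs : 0 < (|a * (1 - ε) + b * β - a - 2 * b| + 1) / (-a) :=
      div_pos (by positivity) (by linarith)
    have := hone _ hs 1 one_pos
    have e : a * ((|a * (1 - ε) + b * β - a - 2 * b| + 1) / (-a)) =
        -(|a * (1 - ε) + b * β - a - 2 * b| + 1) := by
      rw [div_neg, mul_neg, mul_div_cancel₀ _ ha.ne]
    rw [mul_sub, e] at this
    linarith [le_abs_self (a * (1 - ε) + b * β - a - 2 * b)]
  -- Likewise b ≤ 0. Slater's condition excludes b = 0: the test 1 accepts ρ with probability 1 > 1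
  -- - ε, so the slack s = ε is allowed. Only here does ε > 0 enter.
  have hb : b < 0 := by
    by_contra! hb
    rcases hb.eq_or_lt with rfl | hb
    · have := hone ε hε 1 one_pos
      simp at this
    · have ht : 0 < (|a * (1 - ε) + b * β - b - a * (1 - 1)| + 1) / b := by positivity
      have := hone 1 one_pos _ ht
      have e : b * ((|a * (1 - ε) + b * β - b - a * (1 - 1)| + 1) / b) =
        |a * (1 - ε) + b * β - b - a * (1 - 1)| + 1 := by field_simp
      rw [mul_add, e] at this
      linarith [le_abs_self (a * (1 - ε) + b * β - b - a * (1 - 1))]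
  have hμ : 0 ≤ a / (-b) := div_nonneg ha (by linarith)
  have hH : (((a / (-b) : ℝ) : ℂ) • ρ - σ).IsHermitian := by
    refine IsHermitian.sub ?_ hσ.1.1
    rw [IsHermitian, conjTranspose_smul, hρ.1.1.eq, RCLike.star_def, Complex.conj_ofReal]
  obtain ⟨Z, Λ, hZ, hHZ, hΛ0, hΛ1, hΛ⟩ := exists_posPart hH
  refine ⟨a / (-b), Z, hμ, hZ, by rw [add_comm]; exact sub_le_iff_le_add.mp hHZ, ?_⟩
  have h := hle Λ hΛ0 hΛ1
  rw [← hΛ]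
  simp only [Matrix.mul_sub, Matrix.mul_smul, trace_sub, trace_smul, smul_eq_mul, Complex.sub_re,
    Complex.re_ofReal_mul]
  have hb' : 0 < -b := by linarith
  have e : a = a / (-b) * (-b) := (div_mul_cancel₀ a hb'.ne').symm
  have hfin : (-b) * (β - (a / (-b) * (1 - ε) -
      (a / (-b) * (Λ * ρ).trace.re - (Λ * σ).trace.re))) ≤ 0 := by
    generalize a / (-b) = μ at *
    subst e
    nlinarith
  have := nonpos_of_mul_nonpos_right hfin hb'
  linarith

end Duality

/-! ### Marginals and extendible states -/

section Marginal

lemma isClosed_permInvariant {A B : Type*} {k : ℕ} :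
    IsClosed {ω : Matrix (A × (Fin k → B)) (A × (Fin k → B)) ℂ | PermInvariant ω} := by
  simp only [PermInvariant, Set.ofPred_forall]
  exact isClosed_iInter fun π => isClosed_eq (continuous_id.matrix_submatrix _ _) continuous_id

variable {A B : Type*} [Fintype B] {k : ℕ}

lemma marginal_eq_sum_submatrix (i : Fin k) (ω : Matrix (A × (Fin k → B)) (A × (Fin k → B)) ℂ) :
    marginal i ω = ∑ h : {j // j ≠ i} → B,
      ω.submatrix (fun x : A × B => (x.1, (Equiv.funSplitAt i B).symm (x.2, h)))
        (fun x : A × B => (x.1, (Equiv.funSplitAt i B).symm (x.2, h))) := by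
  ext x y
  simp [marginal, Matrix.sum_apply]

lemma posSemidef_marginal (i : Fin k) {ω : Matrix (A × (Fin k → B)) (A × (Fin k → B)) ℂ}
    (hω : ω.PosSemidef) : (marginal i ω).PosSemidef := by
  rw [marginal_eq_sum_submatrix]
  exact posSemidef_sum _ fun h _ => hω.submatrix _

lemma trace_marginal [Fintype A] (i : Fin k) (ω : Matrix (A × (Fin k → B)) (A × (Fin k → B)) ℂ) :
    (marginal i ω).trace = ω.trace := by
  simp only [trace, diag_apply, marginal, of_apply, Fintype.sum_prod_type]
  refine Finset.sum_congr rfl fun a _ => ?_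
  rw [← (Equiv.funSplitAt i B).symm.sum_comp, Fintype.sum_prod_type]

lemma continuous_marginal (i : Fin k) :
    Continuous (marginal i : Matrix (A × (Fin k → B)) (A × (Fin k → B)) ℂ → _) := by
  refine continuous_matrix fun x y => ?_
  simp only [marginal, of_apply]
  fun_prop

variable [Fintype A]

/-- The partial trace preserves positivity and trace, so normalization can be imposed on the
extension instead of on σ, as the semidefinite program does. -/
lemma mem_Ext_iff (hk : 0 < k) {σ : Matrix (A × B) (A × B) ℂ} :
    σ ∈ (Ext k : Set (Matrix (A × B) (A × B) ℂ)) ↔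
      ∃ ω : Matrix (A × (Fin k → B)) (A × (Fin k → B)) ℂ,
        ω.PosSemidef ∧ ω.trace = 1 ∧ PermInvariant ω ∧ marginal ⟨0, hk⟩ ω = σ := by
  constructor
  · rintro ⟨hσ, _, ω, hω, rfl, hp⟩
    exact ⟨ω, hω, (trace_marginal _ ω).symm.trans hσ.2, hp, rfl⟩
  · rintro ⟨ω, hω, ht, hp, rfl⟩
    exact ⟨⟨posSemidef_marginal _ hω, (trace_marginal _ ω).trans ht⟩, hk, ω, hω, rfl, hp⟩

lemma isCompact_Ext (hk : 0 < k) : IsCompact (Ext k : Set (Matrix (A × B) (A × B) ℂ)) := by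
  have hK : IsCompact {ω : Matrix (A × (Fin k → B)) (A × (Fin k → B)) ℂ |
      ω.PosSemidef ∧ ω.trace = 1 ∧ PermInvariant ω} := by
    refine (isCompact_posSemidef_re_trace_le 1).of_isClosed_subset ?_ ?_
    · have ht : IsClosed {ω : Matrix (A × (Fin k → B)) (A × (Fin k → B)) ℂ | ω.trace = 1} :=
        isClosed_eq continuous_id.matrix_trace continuous_const
      exact isClosed_posSemidef.inter (ht.inter isClosed_permInvariant)
    · rintro ω ⟨h, ht, -⟩
      exact ⟨h, by simp [ht]⟩
  convert hK.image (continuous_marginal (A := A) (B := B) (⟨0, hk⟩ : Fin k)) using 1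
  ext σ
  simp [mem_Ext_iff hk, and_assoc]

lemma Ext_nonempty [Nonempty A] [Nonempty B] (hk : 0 < k) :
    (Ext k : Set (Matrix (A × B) (A × B) ℂ)).Nonempty := by
  classical
  have hN : (Fintype.card (A × (Fin k → B)) : ℂ) ≠ 0 := by simp
  refine ⟨_, (mem_Ext_iff hk).mpr ⟨((Fintype.card (A × (Fin k → B)) : ℂ)⁻¹) • 1, ?_, ?_, ?_, rfl⟩⟩
  · exact PosSemidef.one.smul (by positivity)
  · rw [trace_smul, trace_one, smul_eq_mul, inv_mul_cancel₀ hN]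
  · intro π
    have hinj : Function.Injective (Prod.map id fun b => b ∘ π :
        A × (Fin k → B) → A × (Fin k → B)) :=
      Function.injective_id.prodMap π.surjective.injective_comp_right
    rw [submatrix_smul, Pi.smul_apply, Pi.smul_apply, submatrix_one _ hinj]

end Marginal

/-! ### The semidefinite program -/

section SDP

lemma log2_mono : Monotone log2 := fun _ _ h =>
  EReal.div_le_div_right_of_nonneg (EReal.coe_nonneg.mpr (Real.log_nonneg one_le_two))
    (ENNReal.log_monotone h)

lemma iInf_test_ne_top {A : Type*} [Fintype A] [DecidableEq A] {ε : ℝ} (hε : 0 ≤ ε)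
    {ρ : Matrix A A ℂ} (hρ : IsState ρ) (σ : Matrix A A ℂ) :
    (⨅ Λ ∈ {Λ : Matrix A A ℂ | 0 ≤ Λ ∧ Λ ≤ 1 ∧ 1 - ε ≤ (Λ * ρ).trace.re},
      ENNReal.ofReal (Λ * σ).trace.re) ≠ ⊤ := by
  refine ((iInf₂_le 1 ⟨nonneg_iff_posSemidef.mpr PosSemidef.one, le_rfl, ?_⟩).trans_lt
    ENNReal.ofReal_lt_top).ne
  simpa [hρ.2] using hε

variable {A B : Type*} [Fintype A] [DecidableEq A] [Fintype B] [DecidableEq B]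

/-- The divergence is attained, at a state that maximizes the error of the best test. -/
lemma exists_unextDivergence_eq {k : ℕ} (hk : 0 < k) {ε : ℝ} (hε : 0 ≤ ε)
    {ρ : Matrix (A × B) (A × B) ℂ} (hρ : IsState ρ) :
    ∃ v : ℝ, 0 ≤ v ∧ unextDivergence k ε ρ = -log2 (ENNReal.ofReal v) ∧
      (∃ σ ∈ (Ext k : Set (Matrix (A × B) (A × B) ℂ)), ∀ Λ : Matrix (A × B) (A × B) ℂ,
        0 ≤ Λ → Λ ≤ 1 → 1 - ε ≤ (Λ * ρ).trace.re → v ≤ (Λ * σ).trace.re) ∧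
      ∀ σ ∈ (Ext k : Set (Matrix (A × B) (A × B) ℂ)), ∀ w : ℝ,
        (∀ Λ : Matrix (A × B) (A × B) ℂ,
          0 ≤ Λ → Λ ≤ 1 → 1 - ε ≤ (Λ * ρ).trace.re → w ≤ (Λ * σ).trace.re) → w ≤ v := by
  -- A unit trace forces nonempty systems, and then the maximally mixed state is extendible.
  have hne : Nonempty (A × B) := by
    by_contra h
    rw [not_nonempty_iff] at h
    simpa [trace] using hρ.2
  have : Nonempty A := hne.map Prod.fst
  have : Nonempty B := hne.map Prod.snd
  set T := {Λ : Matrix (A × B) (A × B) ℂ | 0 ≤ Λ ∧ Λ ≤ 1 ∧ 1 - ε ≤ (Λ * ρ).trace.re}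
  let β : Matrix (A × B) (A × B) ℂ → ℝ≥0∞ := fun σ => ⨅ Λ ∈ T, ENNReal.ofReal (Λ * σ).trace.re
  -- An infimum of continuous functions is upper semicontinuous, so it attains its maximum on the
  -- compact set of extendible states.
  have husc : UpperSemicontinuous β := upperSemicontinuous_biInf fun Λ _ =>
    (ENNReal.continuous_ofReal.comp (continuous_re_trace_mul_left Λ)).upperSemicontinuous
  obtain ⟨σ, hσ, hmax⟩ := (husc.upperSemicontinuousOn _).exists_isMaxOn (Ext_nonempty hk)
    (isCompact_Ext (A := A) (B := B) hk)
  have hβ : ∀ σ, β σ ≠ ⊤ := iInf_test_ne_top hε hρ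
  have hv : ENNReal.ofReal (β σ).toReal = β σ := ENNReal.ofReal_toReal (hβ σ)
  refine ⟨(β σ).toReal, ENNReal.toReal_nonneg, ?_, ⟨σ, hσ, fun Λ h0 h1 h2 => ?_⟩,
    fun τ hτ w hw => ?_⟩
  · rw [hv]
    refine le_antisymm (iInf₂_le σ hσ) (le_iInf₂ fun τ hτ => ?_)
    exact EReal.neg_le_neg_iff.mpr (log2_mono (hmax hτ))
  · refine ENNReal.toReal_le_of_le_ofReal
      (re_trace_mul_nonneg (nonneg_iff_posSemidef.mp h0) hσ.1.1) ?_
    exact iInf₂_le Λ ⟨h0, h1, h2⟩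
  · refine (ENNReal.ofReal_le_ofReal_iff ENNReal.toReal_nonneg).mp ?_
    rw [hv]
    refine le_trans (le_iInf₂ fun Λ hΛ => ?_) (hmax hτ)
    exact ENNReal.ofReal_le_ofReal (hw Λ hΛ.1 hΛ.2.1 hΛ.2.2)

/-- If the type-I error can be made arbitrarily small at type-II error `u`, it can be removed. -/
lemma exists_test_of_forall_pos {n : Type*} [Fintype n] [DecidableEq n] {ρ σ : Matrix n n ℂ} {u : ℝ}
    (h : ∀ δ > 0, ∃ Λ : Matrix n n ℂ, 0 ≤ Λ ∧ Λ ≤ 1 ∧ 1 - δ ≤ (Λ * ρ).trace.re ∧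
      (Λ * σ).trace.re ≤ u) :
    ∃ Λ : Matrix n n ℂ, 0 ≤ Λ ∧ Λ ≤ 1 ∧ 1 ≤ (Λ * ρ).trace.re ∧ (Λ * σ).trace.re ≤ u := by
  have hK : IsCompact ({Λ : Matrix n n ℂ | 0 ≤ Λ ∧ Λ ≤ 1} ∩ {Λ | (Λ * σ).trace.re ≤ u}) :=
    isCompact_tests.inter_right (isClosed_le (continuous_re_trace_mul_right σ) continuous_const)
  obtain ⟨Λ₀, h0, h1, -, h3⟩ := h 1 one_pos
  -- The test with the largest acceptance of ρ, among those with type-II error at most u, beats 1 -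
  -- δ for every δ.
  obtain ⟨Λ, ⟨⟨hΛ0, hΛ1⟩, hΛ⟩, hmax⟩ := hK.exists_isMaxOn ⟨Λ₀, ⟨h0, h1⟩, h3⟩
    (continuous_re_trace_mul_right ρ).continuousOn
  refine ⟨Λ, hΛ0, hΛ1, le_of_forall_pos_le_add fun δ hδ => ?_, hΛ⟩
  obtain ⟨Γ, g0, g1, g2, g3⟩ := h δ hδ
  have := hmax ⟨⟨g0, g1⟩, g3⟩
  simp only [Set.mem_ofPred_eq] at this
  linarith

/-- ε occurs in the objective but not in the constraints, so a dual point found at one ε stays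
feasible at every ε'. This is what lets the case ε = 0 borrow points from δ > 0. -/
lemma exists_sdpValue_ge {k : ℕ} (hk : 0 < k) {ε v : ℝ} (hε : 0 < ε)
    {ρ σ : Matrix (A × B) (A × B) ℂ} (hρ : IsState ρ)
    (hσ : σ ∈ (Ext k : Set (Matrix (A × B) (A × B) ℂ)))
    (hv : ∀ Λ : Matrix (A × B) (A × B) ℂ, 0 ≤ Λ → Λ ≤ 1 → 1 - ε ≤ (Λ * ρ).trace.re →
      v ≤ (Λ * σ).trace.re) :
    ∃ (μ : ℝ) (z : ℝ), 0 ≤ μ ∧ v ≤ μ * (1 - ε) - z ∧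
      ∀ ε' : ℝ, μ * (1 - ε') - z ∈ sdpValues k ε' ρ := by
  obtain ⟨μ, Z, hμ, hZ, h, hle⟩ := test_strong_duality hρ hσ.1 hε hv
  obtain ⟨ω, hω, ht, hp, rfl⟩ := (mem_Ext_iff hk).mp hσ
  exact ⟨μ, Z.trace.re, hμ, hle, fun ε' => ⟨hk, μ, Z, ω, hμ, hZ, hω.nonneg, h, hp, ht, rfl⟩⟩

/-- The unextendible divergence is the value of the semidefinite program. -/
theorem unextDivergence_sdp {k : ℕ} (hk : 0 < k) {ε : ℝ} (hε : 0 ≤ ε)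
    {ρ : Matrix (A × B) (A × B) ℂ} (hρ : IsState ρ) :
    ∃ v : ℝ, IsLUB (sdpValues k ε ρ) v ∧ (0 < ε → v ∈ sdpValues k ε ρ) ∧
      unextDivergence k ε ρ = -log2 (ENNReal.ofReal v) := by
  obtain ⟨v, -, hE, ⟨σ, hσ, hv⟩, hmax⟩ := exists_unextDivergence_eq (A := A) (B := B) hk hε hρ
  have hub : v ∈ upperBounds (sdpValues k ε ρ) := by
    rintro _ ⟨_, μ, Z, ω, hμ, hZ, hω, h, hp, ht, rfl⟩
    exact hmax _ ((mem_Ext_iff hk).mpr ⟨ω, nonneg_iff_posSemidef.mp hω, ht, hp, rfl⟩) _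
      fun Λ h0 h1 h2 => test_weak_duality hμ hZ h h0 h1 h2
  have hmem : 0 < ε → v ∈ sdpValues k ε ρ := fun hε => by
    obtain ⟨μ, z, -, hle, hz⟩ := exists_sdpValue_ge hk hε hρ hσ hv
    rw [hle.antisymm (hub (hz ε))]
    exact hz ε
  refine ⟨v, ⟨hub, fun u hu => ?_⟩, hmem, hE⟩
  rcases hε.eq_or_lt with rfl | hε
  -- If every test at level 1 - δ had error above u, then so would the best one, and its dual point,
  -- evaluated at ε = 0, would be worth at least as much because μ ≥ 0. That contradicts the upper
  -- bound u. Now let δ tend to 0.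
  · obtain ⟨Λ, h0, h1, h2, h3⟩ : ∃ Λ : Matrix (A × B) (A × B) ℂ, 0 ≤ Λ ∧ Λ ≤ 1 ∧
        1 ≤ (Λ * ρ).trace.re ∧ (Λ * σ).trace.re ≤ u := by
      refine exists_test_of_forall_pos fun δ hδ => ?_
      by_contra! hcon
      obtain ⟨Λ, ⟨⟨h0, h1⟩, h2⟩, hmin⟩ := (isCompact_tests.inter_right
        (isClosed_le continuous_const (continuous_re_trace_mul_right ρ))).exists_isMinOn
        (s := {Λ : Matrix (A × B) (A × B) ℂ | 0 ≤ Λ ∧ Λ ≤ 1} ∩ {Λ | 1 - δ ≤ (Λ * ρ).trace.re})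
        ⟨1, ⟨nonneg_iff_posSemidef.mpr PosSemidef.one, le_rfl⟩, by simpa [hρ.2] using hδ.le⟩
        (continuous_re_trace_mul_right σ).continuousOn
      obtain ⟨μ, z, hμ, hle, hz⟩ := exists_sdpValue_ge (v := (Λ * σ).trace.re) hk hδ hρ hσ
        fun Γ g0 g1 g2 => hmin ⟨⟨g0, g1⟩, g2⟩
      have := hu (hz 0)
      have := hcon Λ h0 h1 h2
      nlinarith
    exact (hv Λ h0 h1 (by simpa using h2)).trans h3
  · exact hu (hmem hε)

end SDP

/-! ### Twisted projections in a star ring -/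

section MatrixUnits

variable {R D : Type*} [Ring R] [StarRing R] [Fintype D]

/-- The relations of a system of matrix units. -/
structure IsMatrixUnits (e : D → D → R) : Prop where
  mul_same : ∀ a b c, e a b * e b c = e a c
  mul_ne : ∀ a {b b'} c, b ≠ b' → e a b * e b' c = 0
  star : ∀ a b, star (e a b) = e b a

/-- The row `∑_b e_{ab} f_{ab} u_b*`, a partial isometry up to normalization. -/
def twistedRow (a : D) (e f : D → D → R) (u : D → R) : R := ∑ b, e a b * f a b * star (u b)

variable {e f g : D → D → R} {u w : D → R}

/-- Both rows use the same units e, those of Alice's key, and e_{ab} e_{b'a} vanishes unless b = b';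
the double sum collapses to its diagonal. No relation between f and g is assumed, so g = f is
allowed. -/
lemma twistedRow_mul_star (he : IsMatrixUnits e) (hg : IsMatrixUnits g) (a : D)
    (hef : ∀ p q r s, Commute (e p q) (f r s)) (heg : ∀ p q r s, Commute (e p q) (g r s))
    (heu : ∀ p q r, Commute (e p q) (u r)) (hew : ∀ p q r, Commute (e p q) (w r))
    (hgu : ∀ p q r, Commute (g p q) (u r)) (hgw : ∀ p q r, Commute (g p q) (w r)) :
    twistedRow a e f u * star (twistedRow a e g w) =
      e a a * ∑ b, f a b * g b a * (star (u b) * w b) := by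
  classical
  have heu' : ∀ p q r, Commute (e p q) (star (u r)) := fun p q r => by
    simpa [he.star] using (heu q p r).star_star
  have hgu' : ∀ p q r, Commute (g p q) (star (u r)) := fun p q r => by
    simpa [hg.star] using (hgu q p r).star_star
  have hterm : ∀ b b', (e a b * f a b * star (u b)) * star (e a b' * g a b' * star (w b')) =
      (e a b * e b' a) * (f a b * g b' a * (star (u b) * w b')) := fun b b' => by
    have h1 : Commute (g b' a) (star (u b) * w b') := (hgu' _ _ _).mul_right (hgw _ _ _)
    have h2 : Commute (e b' a) (f a b * (star (u b) * w b') * g b' a) :=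
      ((hef _ _ _ _).mul_right ((heu' _ _ _).mul_right (hew _ _ _))).mul_right (heg _ _ _ _)
    calc _ = e a b * ((f a b * (star (u b) * w b') * g b' a) * e b' a) := by
          simp only [star_mul, star_star, he.star, hg.star, mul_assoc]
      _ = e a b * (e b' a * (f a b * ((star (u b) * w b') * g b' a))) := by
          rw [← h2.eq]; simp only [mul_assoc]
      _ = _ := by rw [← h1.eq]; simp only [mul_assoc]
  rw [twistedRow, twistedRow, star_sum, Finset.sum_mul_sum, Finset.mul_sum]
  refine Finset.sum_congr rfl fun b _ => ?_
  rw [Finset.sum_eq_single b, hterm, he.mul_same]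
  · intro b' _ hb
    rw [hterm, he.mul_ne _ _ hb.symm, zero_mul]
  · simp

lemma twistedRow_mul_star_self (he : IsMatrixUnits e) (hf : IsMatrixUnits f) (a : D)
    (hef : ∀ p q r s, Commute (e p q) (f r s)) (heu : ∀ p q r, Commute (e p q) (u r))
    (hfu : ∀ p q r, Commute (f p q) (u r)) (hu : ∀ b, star (u b) * u b = 1) :
    twistedRow a e f u * star (twistedRow a e f u) = Fintype.card D • (e a a * f a a) := by
  rw [twistedRow_mul_star he hf a hef hef heu heu hfu hfu]
  simp only [hu, mul_one, hf.mul_same, Finset.sum_const, Finset.card_univ, mul_smul_comm]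

lemma mul_twistedRow (he : IsMatrixUnits e) (hf : IsMatrixUnits f) (a : D)
    (hef : ∀ p q r s, Commute (e p q) (f r s)) :
    e a a * f a a * twistedRow a e f u = twistedRow a e f u := by
  rw [twistedRow, Finset.mul_sum]
  refine Finset.sum_congr rfl fun b _ => ?_
  calc _ = e a a * (f a a * e a b) * (f a b * star (u b)) := by simp only [mul_assoc]
    _ = (e a a * e a b) * (f a a * f a b) * star (u b) := by
        rw [← (hef _ _ _ _).eq]; simp only [mul_assoc]
    _ = _ := by rw [he.mul_same, hf.mul_same]

/-- The overlap of tests on two extensions: f and g are the units of two different Bobs. The factor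
f_{ab} f_{b'a} again forces b = b', the unitaries then cancel in pairs, and the sum of the g_{bb} is
1. No commutation of u with w is required, since both act on Alice's shield. -/
lemma twistedRow_mul_star_mul (he : IsMatrixUnits e) (hf : IsMatrixUnits f) (hg : IsMatrixUnits g)
    (a : D) (hg1 : ∑ b, g b b = 1)
    (hef : ∀ p q r s, Commute (e p q) (f r s)) (heg : ∀ p q r s, Commute (e p q) (g r s))
    (hfg : ∀ p q r s, Commute (f p q) (g r s))
    (heu : ∀ p q r, Commute (e p q) (u r)) (hew : ∀ p q r, Commute (e p q) (w r))
    (hfu : ∀ p q r, Commute (f p q) (u r)) (hfw : ∀ p q r, Commute (f p q) (w r))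
    (hgu : ∀ p q r, Commute (g p q) (u r)) (hgw : ∀ p q r, Commute (g p q) (w r))
    (hu : ∀ b, star (u b) * u b = 1) (hw : ∀ b, w b * star (w b) = 1) :
    (twistedRow a e f u * star (twistedRow a e g w)) *
      (twistedRow a e g w * star (twistedRow a e f u)) = e a a * f a a := by
  classical
  have hfu' : ∀ p q r, Commute (f p q) (star (u r)) := fun p q r => by
    simpa [hf.star] using (hfu q p r).star_star
  have hfw' : ∀ p q r, Commute (f p q) (star (w r)) := fun p q r => by
    simpa [hf.star] using (hfw q p r).star_star
  have hstar : twistedRow a e g w * star (twistedRow a e f u) =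
      star (twistedRow a e f u * star (twistedRow a e g w)) := by rw [star_mul, star_star]
  have hterm : ∀ b b', (f a b * g b a * (star (u b) * w b)) *
      star (f a b' * g b' a * (star (u b') * w b')) =
      (f a b * f b' a) * (g b a * (star (u b) * w b * (star (w b') * u b')) * g a b') :=
    fun b b' => by
    have h : Commute (f b' a) (g b a * (star (u b) * w b * (star (w b') * u b')) * g a b') :=
      ((hfg _ _ _ _).mul_right (((hfu' _ _ _).mul_right (hfw _ _ _)).mul_right
        ((hfw' _ _ _).mul_right (hfu _ _ _)))).mul_right (hfg _ _ _ _)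
    calc _ = f a b * ((g b a * (star (u b) * w b * (star (w b') * u b')) * g a b') * f b' a) := by
          simp only [star_mul, star_star, hf.star, hg.star, mul_assoc]
      _ = _ := by rw [← h.eq]; simp only [mul_assoc]
  have hsum : (∑ b, f a b * g b a * (star (u b) * w b)) *
      star (∑ b, f a b * g b a * (star (u b) * w b)) = f a a := by
    rw [star_sum, Finset.sum_mul_sum]
    calc _ = ∑ b, f a a * g b b := by
          refine Finset.sum_congr rfl fun b _ => ?_
          rw [Finset.sum_eq_single b, hterm, hf.mul_same]
          · have : star (u b) * w b * (star (w b) * u b) = 1 := by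
              rw [mul_assoc, ← mul_assoc (w b), hw, one_mul, hu]
            rw [this, mul_one, hg.mul_same]
          · intro b' _ hb
            rw [hterm, hf.mul_ne _ _ hb.symm, zero_mul]
          · simp
      _ = f a a := by rw [← Finset.mul_sum, hg1, mul_one]
  rw [hstar, twistedRow_mul_star he hg a hef heg heu hew hgu hgw, star_mul, he.star,
    mul_assoc, ← mul_assoc _ _ (e a a), hsum, ← (hef _ _ _ _).eq, ← mul_assoc, he.mul_same]

end MatrixUnits

/-! ### Sums of projections with small overlaps -/

section Projections

variable {n : Type*} [Fintype n] [DecidableEq n]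

/-- For i ≠ j, expanding c⁻¹ XᴴX ≥ 0 with X = cP_j - P_jP_i bounds P_iP_j + P_jP_i by c(P_i + P_j).
Summation gives Q² ≤ mQ for Q = ∑ P_i and m = 1 + (k-1)c, and this forces Q ≤ m. -/
lemma posSemidef_smul_one_sub_sum {k : ℕ} (hk : 0 < k) {c : ℝ} (hc : 0 < c)
    {P : Fin k → Matrix n n ℂ} (hP : ∀ i, (P i)ᴴ = P i) (hPP : ∀ i, P i * P i = P i)
    (hPQ : ∀ i j, i ≠ j → P i * P j * P i = ((c ^ 2 : ℝ) : ℂ) • P i) :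
    (((1 + (k - 1) * c : ℝ) : ℂ) • (1 : Matrix n n ℂ) - ∑ i, P i).PosSemidef := by
  set Q := ∑ i, P i with hQ
  have hQs : Qᴴ = Q := by simp only [hQ, conjTranspose_sum, hP]
  have hpair : ∀ i j, i ≠ j →
      ((c : ℂ) • P i + (c : ℂ) • P j - P i * P j - P j * P i).PosSemidef := fun i j hij => by
    have h := (posSemidef_conjTranspose_mul_self ((c : ℂ) • P j - P j * P i)).smul
      (Complex.zero_le_real.mpr (inv_nonneg.mpr hc.le))
    convert h using 1
    have h1 : P i * P j * (P j * P i) = ((c ^ 2 : ℝ) : ℂ) • P i := by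
      rw [mul_assoc, ← mul_assoc (P j), hPP, ← mul_assoc, hPQ i j hij]
    have h2 : P j * (P j * P i) = P j * P i := by rw [← mul_assoc, hPP]
    have h3 : P i * P j * P j = P i * P j := by rw [mul_assoc, hPP]
    have hc' : (c : ℂ) ≠ 0 := by exact_mod_cast hc.ne'
    simp only [conjTranspose_sub, conjTranspose_smul, conjTranspose_mul, hP, RCLike.star_def,
      Complex.conj_ofReal, Matrix.sub_mul, Matrix.mul_sub, Matrix.smul_mul, Matrix.mul_smul, h1, h2,
      h3, hPP, smul_sub, smul_smul, Complex.ofReal_inv, Complex.ofReal_pow]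
    have e1 : (c : ℂ)⁻¹ * (c * c) = c := by field_simp
    have e2 : (c : ℂ)⁻¹ * c = 1 := by field_simp
    have e3 : (c : ℂ)⁻¹ * c ^ 2 = c := by field_simp
    rw [e1, e2, e3, one_smul, one_smul]
    abel
  have hm : (0 : ℝ) < 1 + (k - 1) * c := by
    have : (1 : ℝ) ≤ k := by exact_mod_cast hk
    have : 0 ≤ ((k : ℝ) - 1) * c := mul_nonneg (by linarith) hc.le
    linarith
  generalize hmm : 1 + ((k : ℝ) - 1) * c = m at hm ⊢
  have hsum : (∑ i, ∑ j, if i = j then 0 else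
      ((c : ℂ) • P i + (c : ℂ) • P j - P i * P j - P j * P i)).PosSemidef := by
    refine posSemidef_sum _ fun i _ => posSemidef_sum _ fun j _ => ?_
    split_ifs with h
    · exact PosSemidef.zero
    · exact hpair i j h
  have hval : (∑ i, ∑ j, if i = j then 0 else
      ((c : ℂ) • P i + (c : ℂ) • P j - P i * P j - P j * P i)) =
      (2 : ℂ) • ((m : ℂ) • Q - Q * Q) := by
    have h1 : ∀ i j, (if i = j then 0 else
        ((c : ℂ) • P i + (c : ℂ) • P j - P i * P j - P j * P i)) =
        -- The sum is completed to all pairs; on the diagonal the summand is (2c - 2)P_i, which is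
        -- subtracted again.
        ((c : ℂ) • P i + (c : ℂ) • P j - P i * P j - P j * P i) -
          (if i = j then (2 * (c : ℂ) - 2) • P i else 0) := fun i j => by
      split_ifs with h
      · subst h
        rw [hPP, sub_smul, two_mul, add_smul, two_smul]
        abel
      · rw [sub_zero]
    simp only [h1, Finset.sum_sub_distrib, Finset.sum_add_distrib, Finset.sum_const,
      Finset.card_univ, Fintype.card_fin, Finset.sum_ite_eq, Finset.mem_univ, if_true]
    have hQQ : ∑ i, ∑ j, P i * P j = Q * Q := by rw [hQ, Finset.sum_mul_sum]
    have hQQ' : ∑ i, ∑ j, P j * P i = Q * Q := by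
      rw [Finset.sum_comm, hQ, Finset.sum_mul_sum]
    rw [hQQ, hQQ', ← Finset.smul_sum, ← Finset.smul_sum, ← hQ, ← Finset.smul_sum, ← hQ, ← hmm]
    have hkk : ∀ X : Matrix n n ℂ, k • X = (k : ℂ) • X := fun X => (Nat.cast_smul_eq_nsmul ℂ k X).symm
    rw [hkk, smul_sub, two_smul, two_smul ℂ (Q * Q)]
    push_cast
    module
  rw [hval] at hsum
  have h1 : ((m : ℂ) • Q - Q * Q).PosSemidef := by
    have := hsum.smul (a := (2 : ℂ)⁻¹) (by positivity)
    rwa [smul_smul, inv_mul_cancel₀ two_ne_zero, one_smul] at this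
  -- Uses m(m - Q) = (mQ - Q²) + (m - Q)².
  have h2 := posSemidef_conjTranspose_mul_self ((m : ℂ) • (1 : Matrix n n ℂ) - Q)
  have h3 := (h1.add h2).smul (Complex.zero_le_real.mpr (inv_nonneg.mpr hm.le))
  convert h3 using 1
  have hm' : (m : ℂ) ≠ 0 := by exact_mod_cast hm.ne'
  simp only [conjTranspose_sub, conjTranspose_smul, conjTranspose_one, hQs, RCLike.star_def,
    Complex.conj_ofReal, Matrix.sub_mul, Matrix.mul_sub, Matrix.smul_mul, Matrix.mul_smul, mul_one,
    one_mul, Complex.ofReal_inv]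
  have : (m : ℂ) • Q - Q * Q + ((m : ℂ) • ((m : ℂ) • 1 - Q) - ((m : ℂ) • Q - Q * Q)) =
    (m : ℂ) • ((m : ℂ) • 1 - Q) := by module
  rw [this, smul_smul, inv_mul_cancel₀ hm', one_smul]

end Projections

/-! ### Operators on `A B_i` -/

section LocalOp

lemma trace_submatrix_equiv {m n : Type*} [Fintype m] [Fintype n] (M : Matrix n n ℂ) (e : m ≃ n) :
    (M.submatrix e e).trace = M.trace :=
  e.sum_comp fun i => M i i

variable {A B C : Type*} [Fintype A] [DecidableEq A] [Fintype B] [DecidableEq B] [Fintype C]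
  [DecidableEq C] {k : ℕ}

/-- The regrouping of `A B₁ ⋯ B_k` into `A B_i` and the remaining `B`-systems. -/
def splitEquiv (A B : Type*) (i : Fin k) : A × (Fin k → B) ≃ (A × B) × ({j // j ≠ i} → B) :=
  ((Equiv.refl A).prodCongr (Equiv.funSplitAt i B)).trans (Equiv.prodAssoc _ _ _).symm

/-- The operator acting as `M` on `A B_i` and as the identity on the other `B`-systems. -/
def localOp (i : Fin k) (M : Matrix (A × B) (A × B) ℂ) :
    Matrix (A × (Fin k → B)) (A × (Fin k → B)) ℂ :=
  (M ⊗ₖ (1 : Matrix ({j // j ≠ i} → B) ({j // j ≠ i} → B) ℂ)).submatrix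
    (splitEquiv A B i) (splitEquiv A B i)

omit [Fintype A] [DecidableEq A] [Fintype B] in
lemma localOp_apply (i : Fin k) (M : Matrix (A × B) (A × B) ℂ) (x y : A × (Fin k → B)) :
    localOp i M x y =
      if ∀ l, l ≠ i → x.2 l = y.2 l then M (x.1, x.2 i) (y.1, y.2 i) else 0 := by
  simp [localOp, splitEquiv, kroneckerMap_apply, one_apply, funext_iff, Equiv.funSplitAt,
    Equiv.piSplitAt]

omit [DecidableEq A] in
lemma localOp_mul (i : Fin k) (M N : Matrix (A × B) (A × B) ℂ) :
    localOp i (M * N) = localOp i M * localOp i N := by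
  rw [localOp, localOp, localOp, submatrix_mul_equiv, ← mul_kronecker_mul, mul_one]

omit [Fintype A] [Fintype B] in
lemma localOp_one (i : Fin k) : localOp i (1 : Matrix (A × B) (A × B) ℂ) = 1 := by
  rw [localOp, one_kronecker_one, submatrix_one_equiv]

omit [Fintype A] [DecidableEq A] [Fintype B] in
lemma localOp_conjTranspose (i : Fin k) (M : Matrix (A × B) (A × B) ℂ) :
    (localOp i M)ᴴ = localOp i Mᴴ := by
  rw [localOp, localOp, conjTranspose_submatrix, conjTranspose_kronecker, conjTranspose_one]

/-- `localOp` as a linear map. -/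
def localOpHom (i : Fin k) :
    Matrix (A × B) (A × B) ℂ →ₗ[ℂ] Matrix (A × (Fin k → B)) (A × (Fin k → B)) ℂ where
  toFun := localOp i
  map_add' M N := by ext; simp [localOp, kroneckerMap_apply, add_mul]
  map_smul' c M := by ext; simp [localOp, kroneckerMap_apply, mul_assoc]

omit [Fintype A] [DecidableEq A] [Fintype B] in
lemma localOp_sum {ι : Type*} (i : Fin k) (s : Finset ι) (M : ι → Matrix (A × B) (A × B) ℂ) :
    localOp i (∑ x ∈ s, M x) = ∑ x ∈ s, localOp i (M x) :=
  map_sum (localOpHom i) M s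

omit [Fintype A] [DecidableEq A] [Fintype B] in
lemma localOp_smul (i : Fin k) (c : ℂ) (M : Matrix (A × B) (A × B) ℂ) :
    localOp i (c • M) = c • localOp i M :=
  map_smul (localOpHom i) c M

omit [Fintype A] [DecidableEq A] [Fintype B] in
lemma localOp_zero (i : Fin k) : localOp i (0 : Matrix (A × B) (A × B) ℂ) = 0 :=
  map_zero (localOpHom i)

omit [Fintype A] [DecidableEq A] [Fintype B] in
-- Alice's system is shared by all extensions, so an operator on it alone does not see the index i.
lemma localOp_kronecker_one (i j : Fin k) (X : Matrix A A ℂ) :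
    localOp i (X ⊗ₖ (1 : Matrix B B ℂ)) = localOp j (X ⊗ₖ (1 : Matrix B B ℂ)) := by
  have h : ∀ (i : Fin k) (x y : A × (Fin k → B)), localOp i (X ⊗ₖ (1 : Matrix B B ℂ)) x y =
      if x.2 = y.2 then X x.1 y.1 else 0 := fun i x y => by
    rw [localOp_apply]
    simp only [kroneckerMap_apply, one_apply]
    by_cases h : x.2 = y.2
    · simp [h]
    · rw [if_neg h]
      split_ifs with h1 h2
      · exact absurd (funext fun l => if hl : l = i then hl ▸ h2 else h1 l hl) h
      · simp
      · rfl
  ext x y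
  rw [h, h]

/-- The two operators act on the disjoint systems B_i and AB_j. In either order a single
intermediate index survives in the matrix product, with the same resulting entry. -/
lemma commute_localOp {i j : Fin k} (hij : i ≠ j) (Y : Matrix B B ℂ)
    (M : Matrix (A × B) (A × B) ℂ) :
    Commute (localOp i ((1 : Matrix A A ℂ) ⊗ₖ Y)) (localOp j M) := by
  have hY : ∀ x z : A × (Fin k → B), localOp i ((1 : Matrix A A ℂ) ⊗ₖ Y) x z =
      if x.1 = z.1 ∧ ∀ l, l ≠ i → x.2 l = z.2 l then Y (x.2 i) (z.2 i) else 0 := fun x z => by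
    rw [localOp_apply, kroneckerMap_apply, one_apply, ite_and]
    split_ifs <;> simp
  ext x y
  have hL : (localOp i ((1 : Matrix A A ℂ) ⊗ₖ Y) * localOp j M) x y =
      if ∀ l, l ≠ i → l ≠ j → x.2 l = y.2 l then
        Y (x.2 i) (y.2 i) * M (x.1, x.2 j) (y.1, y.2 j) else 0 := by
    rw [mul_apply, Finset.sum_eq_single (x.1, Function.update x.2 i (y.2 i))]
    · rw [hY, localOp_apply, if_pos ⟨rfl, fun l hl => by simp [Function.update_of_ne hl]⟩, mul_ite,
        mul_zero]
      simp only [Function.update_self, Function.update_of_ne hij.symm]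
      refine if_congr (forall_congr' fun l => ?_) rfl rfl
      by_cases hl : l = i
      · subst hl; simp
      · simp [hl]
    · intro z _ hz
      rw [hY, localOp_apply]
      split_ifs with h1 h2 <;> try simp only [zero_mul, mul_zero]
      refine (hz (Prod.ext h1.1.symm (funext fun l => ?_))).elim
      by_cases hl : l = i
      · subst hl; simpa using h2 l hij
      · simpa [hl] using (h1.2 l hl).symm
    · simp
  have hR : (localOp j M * localOp i ((1 : Matrix A A ℂ) ⊗ₖ Y)) x y =
      if ∀ l, l ≠ i → l ≠ j → x.2 l = y.2 l then
        Y (x.2 i) (y.2 i) * M (x.1, x.2 j) (y.1, y.2 j) else 0 := by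
    rw [mul_apply, Finset.sum_eq_single (y.1, Function.update y.2 i (x.2 i))]
    · rw [hY, localOp_apply, if_pos (c := _ ∧ _) ⟨rfl, fun l hl => by simp [Function.update_of_ne hl]⟩,
        ite_mul, zero_mul, mul_comm]
      simp only [Function.update_self, Function.update_of_ne hij.symm]
      refine if_congr (forall_congr' fun l => ?_) rfl rfl
      by_cases hl : l = i
      · subst hl; simp
      · simp [hl]
    · intro z _ hz
      rw [hY, localOp_apply]
      split_ifs with h1 h2 <;> try simp only [zero_mul, mul_zero]
      refine (hz (Prod.ext h2.1 (funext fun l => ?_))).elim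
      by_cases hl : l = i
      · subst hl; simpa using (h1 l hij).symm
      · simpa [hl] using h2.2 l hl
    · simp
  rw [hL, hR]

omit [DecidableEq A] in
-- Tensoring with the identity is the adjoint of the partial trace.
lemma trace_mul_marginal (i : Fin k) (M : Matrix (A × B) (A × B) ℂ)
    (ω : Matrix (A × (Fin k → B)) (A × (Fin k → B)) ℂ) :
    (M * marginal i ω).trace = (localOp i M * ω).trace := by
  have h : localOp i M * ω = ((M ⊗ₖ (1 : Matrix ({j // j ≠ i} → B) ({j // j ≠ i} → B) ℂ)) *
      ω.submatrix (splitEquiv A B i).symm (splitEquiv A B i).symm).submatrix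
        (splitEquiv A B i) (splitEquiv A B i) := by
    rw [← submatrix_mul_equiv _ _ _ (splitEquiv A B i), submatrix_submatrix]
    simp [localOp]
  rw [h, trace_submatrix_equiv]
  simp only [trace, diag_apply, mul_apply, marginal, of_apply, Fintype.sum_prod_type (α₁ := A × B),
    kroneckerMap_apply, one_apply, submatrix_apply, Finset.mul_sum]
  refine Finset.sum_congr rfl fun x _ => ?_
  rw [Finset.sum_comm]
  simp [splitEquiv]

omit [Fintype A] [DecidableEq A] [Fintype B] in
lemma localOp_eq_submatrix_swap (i j : Fin k) (M : Matrix (A × B) (A × B) ℂ) :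
    localOp i M = (localOp j M).submatrix (Prod.map id fun b => b ∘ Equiv.swap i j)
      (Prod.map id fun b => b ∘ Equiv.swap i j) := by
  ext x y
  rw [submatrix_apply, localOp_apply, localOp_apply]
  simp only [Prod.map_fst, Prod.map_snd, id, Function.comp_apply, Equiv.swap_apply_right]
  refine if_congr ?_ rfl rfl
  rw [← (Equiv.swap i j).forall_congr_right]
  refine forall_congr' fun l => ?_
  rw [Ne, Ne, Equiv.swap_apply_eq_iff, Equiv.swap_apply_left]

omit [DecidableEq A] in
-- Swapping B_i and B_j carries one local copy of M to the other and fixes ω. Hence one expectation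
-- can be replaced by the average over all extensions.
lemma PermInvariant.trace_localOp_mul {ω : Matrix (A × (Fin k → B)) (A × (Fin k → B)) ℂ}
    (hω : PermInvariant ω) (i j : Fin k) (M : Matrix (A × B) (A × B) ℂ) :
    (localOp i M * ω).trace = (localOp j M * ω).trace := by
  let s : A × (Fin k → B) ≃ A × (Fin k → B) :=
    (Equiv.refl A).prodCongr ((Equiv.swap i j).symm.arrowCongr (Equiv.refl B))
  have hs : ⇑s = Prod.map id fun b => b ∘ Equiv.swap i j := by
    ext <;> simp [s]
  rw [localOp_eq_submatrix_swap i j]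
  nth_rewrite 1 [← hω (Equiv.swap i j)]
  rw [← hs, submatrix_mul_equiv, trace_submatrix_equiv]

/-- The tensor power of a matrix over an index type. -/
def tensorPow (H : Type*) [Fintype H] (V : Matrix C B ℂ) : Matrix (H → C) (H → B) ℂ :=
  Matrix.of fun c b => ∏ l, V (c l) (b l)

omit [Fintype B] [DecidableEq C] in
lemma tensorPow_conjTranspose_mul_self (H : Type*) [Fintype H] [DecidableEq H] {V : Matrix C B ℂ}
    (hV : Vᴴ * V = 1) : (tensorPow H V)ᴴ * tensorPow H V = 1 := by
  ext b b'
  have h : ∀ l, ∑ c, star (V c (b l)) * V c (b' l) = if b l = b' l then 1 else 0 := fun l => by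
    have := congrFun (congrFun hV (b l)) (b' l)
    simpa [mul_apply, one_apply] using this
  simp only [mul_apply, conjTranspose_apply, tensorPow, of_apply, star_prod,
    ← Finset.prod_mul_distrib]
  rw [← Fintype.prod_sum (f := fun l c => star (V c (b l)) * V c (b' l))]
  simp only [h, one_apply, funext_iff]
  exact Finset.prod_ite_zero.trans (by simp)

variable {A' : Type*} [Fintype A'] [DecidableEq A']

omit [Fintype A] [DecidableEq A] [DecidableEq A'] in
omit [Fintype B] in
-- On the extensions other than i only VᴴV = 1 remains. This is why Bob's channel is dilated to an
-- isometry instead of being treated one Kraus operator at a time.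
lemma conj_localOp (i : Fin k) (E : Matrix A' A ℂ) {V : Matrix C B ℂ} (hV : Vᴴ * V = 1)
    (M : Matrix (A' × C) (A' × C) ℂ) :
    (E ⊗ₖ tensorPow (Fin k) V)ᴴ * localOp i M * (E ⊗ₖ tensorPow (Fin k) V) =
      localOp i ((E ⊗ₖ V)ᴴ * M * (E ⊗ₖ V)) := by
  have h : E ⊗ₖ tensorPow (Fin k) V =
      ((E ⊗ₖ V) ⊗ₖ tensorPow {j // j ≠ i} V).submatrix (splitEquiv A' C i) (splitEquiv A B i) := by
    ext x y
    simp only [kroneckerMap_apply, tensorPow, of_apply, submatrix_apply, splitEquiv]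
    rw [Fintype.prod_eq_mul_prod_subtype_ne _ i]
    simp [mul_assoc]
  rw [h, localOp, localOp, conjTranspose_submatrix, submatrix_mul_equiv, submatrix_mul_equiv,
    conjTranspose_kronecker, ← mul_kronecker_mul, ← mul_kronecker_mul, Matrix.mul_one,
    tensorPow_conjTranspose_mul_self _ hV]

end LocalOp

/-! ### Privacy tests on one of the extensions -/

section PrivacyTest

variable {d : ℕ} {S T : Type*} [Fintype S] [DecidableEq S] [Fintype T] [DecidableEq T]

/-- The projection `V (Φᵈ ⊗ I) V†` onto the support of the private states with twisting unitaries
`U`, in the tensor order `(AB)(A'B')`. -/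
noncomputable def keyTest (U : Fin d → Matrix (S × T) (S × T) ℂ) :
    Matrix ((Fin d × Fin d) × (S × T)) ((Fin d × Fin d) × (S × T)) ℂ :=
  (d : ℂ)⁻¹ • ∑ a, ∑ b, (single a b 1 ⊗ₖ single a b 1) ⊗ₖ (U a * (U b)ᴴ)

/-- The operator `keyTest U` in the tensor order `(AA')(BB')`. -/
noncomputable def privacyTest (U : Fin d → Matrix (S × T) (S × T) ℂ) :
    Matrix ((Fin d × S) × (Fin d × T)) ((Fin d × S) × (Fin d × T)) ℂ :=
  (keyTest U).submatrix (Equiv.prodProdProdComm _ _ _ _) (Equiv.prodProdProdComm _ _ _ _)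

/-- The operator `X ⊗ Y` on keys and shields, in the tensor order `(AA')(BB')`. -/
def keyShieldOp (X : Matrix (Fin d × Fin d) (Fin d × Fin d) ℂ) (Y : Matrix (S × T) (S × T) ℂ) :
    Matrix ((Fin d × S) × (Fin d × T)) ((Fin d × S) × (Fin d × T)) ℂ :=
  (X ⊗ₖ Y).submatrix (Equiv.prodProdProdComm _ _ _ _) (Equiv.prodProdProdComm _ _ _ _)

omit [DecidableEq S] [DecidableEq T] in
lemma keyShieldOp_mul (X X' : Matrix (Fin d × Fin d) (Fin d × Fin d) ℂ)
    (Y Y' : Matrix (S × T) (S × T) ℂ) :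
    keyShieldOp X Y * keyShieldOp X' Y' = keyShieldOp (X * X') (Y * Y') := by
  rw [keyShieldOp, keyShieldOp, keyShieldOp, submatrix_mul_equiv, ← mul_kronecker_mul]

omit [Fintype S] [DecidableEq S] [Fintype T] [DecidableEq T] in
lemma star_keyShieldOp (X : Matrix (Fin d × Fin d) (Fin d × Fin d) ℂ)
    (Y : Matrix (S × T) (S × T) ℂ) : star (keyShieldOp X Y) = keyShieldOp (star X) (star Y) := by
  simp only [star_eq_conjTranspose, keyShieldOp, conjTranspose_submatrix, conjTranspose_kronecker]

omit [Fintype S] [Fintype T] in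
lemma keyShieldOp_one :
    keyShieldOp (1 : Matrix (Fin d × Fin d) (Fin d × Fin d) ℂ) (1 : Matrix (S × T) (S × T) ℂ) =
      1 := by
  rw [keyShieldOp, one_kronecker_one, submatrix_one_equiv]

/-- Matrix units of Alice's key system. -/
def aliceUnit (S T : Type*) [DecidableEq S] [DecidableEq T] (a b : Fin d) :
    Matrix ((Fin d × S) × (Fin d × T)) ((Fin d × S) × (Fin d × T)) ℂ :=
  keyShieldOp (single a b 1 ⊗ₖ 1) 1

/-- Matrix units of Bob's key system. -/
def bobUnit (S T : Type*) [DecidableEq S] [DecidableEq T] (a b : Fin d) :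
    Matrix ((Fin d × S) × (Fin d × T)) ((Fin d × S) × (Fin d × T)) ℂ :=
  keyShieldOp (1 ⊗ₖ single a b 1) 1

omit [Fintype S] [Fintype T] in
-- This form, with the identity on all of Bob's side, is the one `localOp_kronecker_one` accepts.
lemma aliceUnit_eq (a b : Fin d) :
    aliceUnit S T a b = (single a b 1 ⊗ₖ (1 : Matrix S S ℂ)) ⊗ₖ (1 : Matrix (Fin d × T) _ ℂ) := by
  ext ⟨⟨a₁, s₁⟩, b₁, t₁⟩ ⟨⟨a₂, s₂⟩, b₂, t₂⟩
  simp only [aliceUnit, keyShieldOp, submatrix_apply, kroneckerMap_apply, one_apply,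
    Equiv.prodProdProdComm_apply, Prod.mk.injEq, ite_and, mul_ite, mul_one, mul_zero]
  split_ifs <;> rfl

omit [Fintype S] [Fintype T] in
lemma bobUnit_eq (a b : Fin d) :
    bobUnit S T a b = (1 : Matrix (Fin d × S) _ ℂ) ⊗ₖ (single a b 1 ⊗ₖ (1 : Matrix T T ℂ)) := by
  ext ⟨⟨a₁, s₁⟩, b₁, t₁⟩ ⟨⟨a₂, s₂⟩, b₂, t₂⟩
  simp only [bobUnit, keyShieldOp, submatrix_apply, kroneckerMap_apply, one_apply,
    Equiv.prodProdProdComm_apply, Prod.mk.injEq, ite_and, mul_ite, ite_mul, mul_one, mul_zero,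
    one_mul, zero_mul]
  split_ifs <;> rfl

omit [Fintype S] [Fintype T] in
lemma sum_bobUnit : ∑ b, bobUnit (d := d) S T b b = 1 := by
  have h : ∑ b : Fin d, single b b (1 : ℂ) = 1 := by
    rw [← diagonal_one, ← sum_single_eq_diagonal]
  rw [← one_kronecker_one (α := ℂ) (m := Fin d × S) (n := Fin d × T),
    ← one_kronecker_one (α := ℂ) (m := Fin d) (n := T), ← h]
  simp only [bobUnit_eq]
  ext x y
  simp only [Matrix.sum_apply, kroneckerMap_apply, Finset.mul_sum, Finset.sum_mul]

lemma isMatrixUnits_aliceUnit : IsMatrixUnits (aliceUnit (d := d) S T) where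
  mul_same a b c := by
    simp only [aliceUnit, keyShieldOp_mul, ← mul_kronecker_mul, single_mul_single_same, mul_one]
  mul_ne a b b' c h := by
    simp only [aliceUnit, keyShieldOp_mul, ← mul_kronecker_mul, single_mul_single_of_ne _ _ _ _ h]
    ext; simp [keyShieldOp]
  star a b := by
    rw [aliceUnit, star_keyShieldOp]
    simp [aliceUnit, star_eq_conjTranspose, conjTranspose_kronecker]

lemma isMatrixUnits_bobUnit : IsMatrixUnits (bobUnit (d := d) S T) where
  mul_same a b c := by
    simp only [bobUnit, keyShieldOp_mul, ← mul_kronecker_mul, single_mul_single_same, mul_one]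
  mul_ne a b b' c h := by
    simp only [bobUnit, keyShieldOp_mul, ← mul_kronecker_mul, single_mul_single_of_ne _ _ _ _ h]
    ext; simp [keyShieldOp]
  star a b := by
    rw [bobUnit, star_keyShieldOp]
    simp [bobUnit, star_eq_conjTranspose, conjTranspose_kronecker]

lemma commute_aliceUnit_bobUnit (p q r s : Fin d) :
    Commute (aliceUnit S T p q) (bobUnit S T r s) := by
  simp only [Commute, SemiconjBy, aliceUnit, bobUnit, keyShieldOp_mul, ← mul_kronecker_mul, mul_one,
    one_mul]

lemma commute_keyShieldOp (X : Matrix (Fin d × Fin d) (Fin d × Fin d) ℂ)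
    (Y : Matrix (S × T) (S × T) ℂ) : Commute (keyShieldOp X 1) (keyShieldOp 1 Y) := by
  simp only [Commute, SemiconjBy, keyShieldOp_mul, mul_one, one_mul]

/-- In the product of the adjoint row with the row, e_{ba} e_{ab'} = e_{bb'} erases the index a, so
any row represents the test. -/
lemma privacyTest_eq (U : Fin d → Matrix (S × T) (S × T) ℂ) (a : Fin d) :
    privacyTest U = (d : ℂ)⁻¹ •
      (star (twistedRow a (aliceUnit S T) (bobUnit S T) fun b => keyShieldOp 1 (U b)) *
        twistedRow a (aliceUnit S T) (bobUnit S T) fun b => keyShieldOp 1 (U b)) := by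
  have h : ∀ b, aliceUnit S T a b * bobUnit S T a b * star (keyShieldOp 1 (U b)) =
      keyShieldOp (single a b 1 ⊗ₖ single a b 1) (star (U b)) := fun b => by
    simp only [aliceUnit, bobUnit, star_keyShieldOp, keyShieldOp_mul, ← mul_kronecker_mul, mul_one,
      one_mul, star_one]
  simp only [twistedRow, h]
  simp only [star_sum, star_keyShieldOp, star_star, Finset.sum_mul_sum, keyShieldOp_mul]
  simp only [star_eq_conjTranspose, conjTranspose_kronecker, conjTranspose_single,
    ← mul_kronecker_mul, star_one, single_mul_single_same, mul_one]
  ext x y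
  simp [privacyTest, keyTest, keyShieldOp, Matrix.sum_apply]

section Local

variable {k : ℕ} (i j : Fin k)

lemma IsMatrixUnits.localOp {A B D : Type*} [Fintype A] [DecidableEq A] [Fintype B] [DecidableEq B]
    {e : D → D → Matrix (A × B) (A × B) ℂ} (he : IsMatrixUnits e) :
    IsMatrixUnits fun a b => localOp i (e a b) where
  mul_same a b c := by rw [← localOp_mul, he.mul_same]
  mul_ne a b b' c h := by rw [← localOp_mul, he.mul_ne _ _ h, localOp_zero]
  star a b := by rw [star_eq_conjTranspose, localOp_conjTranspose, ← star_eq_conjTranspose, he.star]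

lemma Commute.localOp {A B : Type*} [Fintype A] [DecidableEq A] [Fintype B] [DecidableEq B]
    {M N : Matrix (A × B) (A × B) ℂ} (h : Commute M N) :
    Commute (localOp i M) (localOp i N) := by
  rw [Commute, SemiconjBy, ← localOp_mul, ← localOp_mul, h.eq]

omit [Fintype S] [Fintype T] in
lemma localOp_aliceUnit (a b : Fin d) :
    localOp i (aliceUnit S T a b) = localOp j (aliceUnit S T a b) := by
  rw [aliceUnit_eq, localOp_kronecker_one i j]

/-- The row operator of the privacy test, acting on the `i`-th extension. -/
def localRow (a : Fin d) (U : Fin d → Matrix (S × T) (S × T) ℂ) :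
    Matrix ((Fin d × S) × (Fin k → Fin d × T)) ((Fin d × S) × (Fin k → Fin d × T)) ℂ :=
  twistedRow a (fun p q => localOp i (aliceUnit S T p q)) (fun p q => localOp i (bobUnit S T p q))
    fun b => localOp i (keyShieldOp 1 (U b))

lemma localOp_privacyTest (U : Fin d → Matrix (S × T) (S × T) ℂ) (a : Fin d) :
    localOp i (privacyTest U) = (d : ℂ)⁻¹ • (star (localRow i a U) * localRow i a U) := by
  have : localRow i a U = localOp i
      (twistedRow a (aliceUnit S T) (bobUnit S T) fun b => keyShieldOp 1 (U b)) := by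
    simp only [localRow, twistedRow, localOp_sum, localOp_mul, star_eq_conjTranspose,
      localOp_conjTranspose]
  rw [this, privacyTest_eq U a, localOp_smul, localOp_mul, star_eq_conjTranspose,
    star_eq_conjTranspose, localOp_conjTranspose]

variable {i j} {U : Fin d → Matrix (S × T) (S × T) ℂ}

lemma localOp_keyShieldOp_star_mul (hU : ∀ b, star (U b) * U b = 1) (b : Fin d) :
    star (localOp i (keyShieldOp (d := d) 1 (U b))) * localOp i (keyShieldOp 1 (U b)) = 1 := by
  rw [star_eq_conjTranspose, localOp_conjTranspose, ← star_eq_conjTranspose, star_keyShieldOp,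
    ← localOp_mul, keyShieldOp_mul, hU, star_one, mul_one, keyShieldOp_one, localOp_one]

lemma localOp_keyShieldOp_mul_star (hU : ∀ b, U b * star (U b) = 1) (b : Fin d) :
    localOp i (keyShieldOp (d := d) 1 (U b)) * star (localOp i (keyShieldOp 1 (U b))) = 1 := by
  rw [star_eq_conjTranspose, localOp_conjTranspose, ← star_eq_conjTranspose, star_keyShieldOp,
    ← localOp_mul, keyShieldOp_mul, hU, star_one, mul_one, keyShieldOp_one, localOp_one]

lemma localRow_mul_star (a : Fin d) (hU : ∀ b, star (U b) * U b = 1) :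
    localRow i a U * star (localRow i a U) =
      d • (localOp i (aliceUnit S T a a) * localOp i (bobUnit S T a a)) := by
  rw [localRow, twistedRow_mul_star_self (isMatrixUnits_aliceUnit.localOp i)
    (isMatrixUnits_bobUnit.localOp i), Fintype.card_fin]
  · exact fun p q r s => Commute.localOp i (commute_aliceUnit_bobUnit p q r s)
  · exact fun p q r => Commute.localOp i (commute_keyShieldOp _ _)
  · exact fun p q r => Commute.localOp i (commute_keyShieldOp _ _)
  · exact localOp_keyShieldOp_star_mul hU

lemma mul_localRow (a : Fin d) :
    localOp i (aliceUnit S T a a) * localOp i (bobUnit S T a a) * localRow i a U =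
      localRow i a U :=
  mul_twistedRow (isMatrixUnits_aliceUnit.localOp i) (isMatrixUnits_bobUnit.localOp i) a
    fun p q r s => Commute.localOp i (commute_aliceUnit_bobUnit p q r s)

lemma localRow_mul_star_mul (hij : i ≠ j) (a : Fin d) (hU : ∀ b, star (U b) * U b = 1)
    (hU' : ∀ b, U b * star (U b) = 1) :
    (localRow i a U * star (localRow j a U)) * (localRow j a U * star (localRow i a U)) =
      localOp i (aliceUnit S T a a) * localOp i (bobUnit S T a a) := by
  -- The row of extension j is rewritten with extension i's copy of Alice's units, which gives both
  -- rows a common e.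
  have hj : localRow j a U = twistedRow a (fun p q => localOp i (aliceUnit S T p q))
      (fun p q => localOp j (bobUnit S T p q)) fun b => localOp j (keyShieldOp 1 (U b)) := by
    simp only [localRow, localOp_aliceUnit j i]
  rw [hj, localRow]
  refine twistedRow_mul_star_mul (isMatrixUnits_aliceUnit.localOp i)
    (isMatrixUnits_bobUnit.localOp i) (isMatrixUnits_bobUnit.localOp j) a ?_ ?_ ?_ ?_ ?_ ?_ ?_ ?_ ?_
    ?_ (localOp_keyShieldOp_star_mul hU) (localOp_keyShieldOp_mul_star hU')
  · rw [← localOp_sum, sum_bobUnit, localOp_one]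
  · exact fun p q r s => Commute.localOp i (commute_aliceUnit_bobUnit p q r s)
  · exact fun p q r s => by
      rw [localOp_aliceUnit i j]
      exact Commute.localOp j (commute_aliceUnit_bobUnit p q r s)
  · exact fun p q r s => by
      rw [bobUnit_eq]
      exact commute_localOp hij _ _
  · exact fun p q r => Commute.localOp i (commute_keyShieldOp _ _)
  · exact fun p q r => by
      rw [localOp_aliceUnit i j]
      exact Commute.localOp j (commute_keyShieldOp _ _)
  · exact fun p q r => Commute.localOp i (commute_keyShieldOp _ _)
  · exact fun p q r => by
      rw [bobUnit_eq]
      exact commute_localOp hij _ _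
  · exact fun p q r => by
      rw [bobUnit_eq]
      exact commute_localOp hij.symm _ _
  · exact fun p q r => Commute.localOp j (commute_keyShieldOp _ _)

/-- The privacy tests on `k` extensions have average at most `1/k + 1/d - 1/(kd)`. -/
lemma posSemidef_sub_sum_localOp_privacyTest (hk : 0 < k) (hd : 0 < d)
    (hU : ∀ b, star (U b) * U b = 1) (hU' : ∀ b, U b * star (U b) = 1) :
    (((1 + (k - 1) * (d : ℝ)⁻¹ : ℝ) : ℂ) • 1 -
      ∑ i : Fin k, localOp i (privacyTest U)).PosSemidef := by
  have hd' : (d : ℂ) ≠ 0 := by exact_mod_cast hd.ne'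
  let a : Fin d := ⟨0, hd⟩
  refine posSemidef_smul_one_sub_sum hk (by positivity) (fun i => ?_) (fun i => ?_)
    fun i j hij => ?_
  · rw [localOp_privacyTest i U a, ← star_eq_conjTranspose, star_smul, star_mul, star_star]
    simp
  · rw [localOp_privacyTest i U a, smul_mul_smul_comm]
    have : star (localRow i a U) * localRow i a U * (star (localRow i a U) * localRow i a U) =
        (d : ℂ) • (star (localRow i a U) * localRow i a U) := by
      calc _ = star (localRow i a U) * (localRow i a U * star (localRow i a U)) *
            localRow i a U := by simp only [mul_assoc]
        _ = _ := by
          rw [localRow_mul_star a hU, ← Nat.cast_smul_eq_nsmul ℂ, mul_smul_comm, smul_mul_assoc,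
            mul_assoc, mul_localRow]
    rw [this, smul_smul, mul_assoc, inv_mul_cancel₀ hd', mul_one]
  -- With P_i = d⁻¹ R_i* R_i, the product P_i P_j P_i carries d⁻³ and its middle factor is absorbed
  -- by R_i; what is left is d⁻³ R_i* R_i = d⁻² P_i, so c = 1/d.
  · rw [localOp_privacyTest i U a, localOp_privacyTest j U a, smul_mul_smul_comm,
      smul_mul_smul_comm, smul_smul]
    have : star (localRow i a U) * localRow i a U * (star (localRow j a U) * localRow j a U) *
        (star (localRow i a U) * localRow i a U) = star (localRow i a U) * localRow i a U := by
      calc _ = star (localRow i a U) * ((localRow i a U * star (localRow j a U)) *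
            (localRow j a U * star (localRow i a U))) * localRow i a U := by simp only [mul_assoc]
        _ = _ := by rw [localRow_mul_star_mul hij a hU hU', mul_assoc, mul_localRow]
    rw [this]
    congr 1
    push_cast
    ring

end Local

end PrivacyTest

/-! ### Kraus representations -/

section Kraus

variable {A A' B B' : Type*} [Fintype A] [DecidableEq A] [Fintype A'] [DecidableEq A']
  [Fintype B] [DecidableEq B] [Fintype B'] [DecidableEq B']

omit [DecidableEq A'] in
/-- The Choi–Kraus theorem. -/
lemma IsCP.exists_kraus {𝓔 : Matrix A A ℂ →ₗ[ℂ] Matrix A' A' ℂ} (h : IsCP 𝓔) :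
    ∃ K : A × A' → Matrix A' A ℂ, ∀ X, 𝓔 X = ∑ m, K m * X * (K m)ᴴ := by
  let e : Fin (Fintype.card A) ≃ A := (Fintype.equivFin A).symm
  -- The unnormalized maximally entangled vector, whose image is the Choi matrix. The reference
  -- system is a `Fin`, as `IsCP` demands, and is relabelled by `e`.
  let φ : Fin (Fintype.card A) × A → ℂ := fun x => if e x.1 = x.2 then 1 else 0
  have hC := (h _ _ (posSemidef_vecMulVec_self_star φ)).submatrix
    (fun x : A × A' => (e.symm x.1, x.2))
  have hCe : ∀ x y : A × A', (tensorMap (LinearMap.id : Matrix (Fin (Fintype.card A)) _ ℂ →ₗ[ℂ] _) 𝓔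
      (vecMulVec φ (star φ))).submatrix (fun x : A × A' => (e.symm x.1, x.2))
      (fun x : A × A' => (e.symm x.1, x.2)) x y = 𝓔 (single x.1 y.1 1) x.2 y.2 := fun x y => by
    simp only [tensorMap, LinearMap.coe_mk, AddHom.coe_mk, submatrix_apply, of_apply,
      LinearMap.id_apply]
    refine congrFun (congrFun (congrArg 𝓔 ?_) _) _
    ext p q
    simp [φ, vecMulVec_apply, single_apply, ite_and]
    split_ifs <;> rfl
  obtain ⟨Y, hY⟩ := exists_eq_conjTranspose_mul_self hC
  -- Each row of a factor Y of the Choi matrix YᴴY, reshaped and conjugated, is a Kraus operator.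
  refine ⟨fun m => of fun p a => star (Y m (a, p)), fun X => ?_⟩
  have hX : X = ∑ a, ∑ b, X a b • single a b 1 := by
    conv_lhs => rw [matrix_eq_sum_single X]
    simp
  ext p q
  have hE : ∀ a b, 𝓔 (single a b 1) p q = ∑ m, star (Y m (a, p)) * Y m (b, q) := fun a b => by
    rw [← hCe (a, p) (b, q), hY, mul_apply]
    rfl
  conv_lhs => rw [hX]
  simp only [map_sum, map_smul, Matrix.sum_apply, Matrix.smul_apply, hE, smul_eq_mul, mul_apply,
    of_apply, conjTranspose_apply, star_star, Finset.mul_sum, Finset.sum_mul]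
  calc _ = ∑ b, ∑ a, ∑ m, X a b * (star (Y m (a, p)) * Y m (b, q)) := Finset.sum_comm
    _ = ∑ b, ∑ m, ∑ a, X a b * (star (Y m (a, p)) * Y m (b, q)) :=
      Finset.sum_congr rfl fun b _ => Finset.sum_comm
    _ = ∑ m, ∑ b, ∑ a, X a b * (star (Y m (a, p)) * Y m (b, q)) := Finset.sum_comm
    _ = _ := by
      refine Finset.sum_congr rfl fun m _ => Finset.sum_congr rfl fun b _ =>
        Finset.sum_congr rfl fun a _ => ?_
      ring

omit [DecidableEq A'] in
lemma sum_conjTranspose_mul_self_eq_one {ι : Type*} [Fintype ι] {K : ι → Matrix A' A ℂ}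
    (h : ∀ X : Matrix A A ℂ, (∑ m, K m * X * (K m)ᴴ).trace = X.trace) :
    ∑ m, (K m)ᴴ * K m = 1 := by
  rw [ext_iff_trace_mul_right]
  intro X
  rw [one_mul, ← h X, Matrix.sum_mul, trace_sum, trace_sum]
  refine Finset.sum_congr rfl fun m _ => ?_
  rw [trace_mul_comm (K m * X), Matrix.mul_assoc]

omit [DecidableEq A] [Fintype A'] [DecidableEq A'] [DecidableEq B] [Fintype B'] [DecidableEq B'] in
lemma tensorMap_kraus {ι κ : Type*} [Fintype ι] [Fintype κ]
    {𝓔 : Matrix A A ℂ →ₗ[ℂ] Matrix A' A' ℂ} {𝓕 : Matrix B B ℂ →ₗ[ℂ] Matrix B' B' ℂ}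
    {K : ι → Matrix A' A ℂ} {L : κ → Matrix B' B ℂ} (hK : ∀ X, 𝓔 X = ∑ m, K m * X * (K m)ᴴ)
    (hL : ∀ X, 𝓕 X = ∑ n, L n * X * (L n)ᴴ) (X : Matrix (A × B) (A × B) ℂ) :
    tensorMap 𝓔 𝓕 X = ∑ m, ∑ n, (K m ⊗ₖ L n) * X * (K m ⊗ₖ L n)ᴴ := by
  ext x y
  simp only [tensorMap, LinearMap.coe_mk, AddHom.coe_mk, of_apply, hK, hL, Matrix.sum_apply,
    mul_apply, conjTranspose_apply, kroneckerMap_apply, Fintype.sum_prod_type, Finset.mul_sum,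
    Finset.sum_mul, star_mul']
  refine Finset.sum_congr rfl fun m _ => ?_
  calc _ = ∑ j, ∑ n, ∑ i, ∑ q, ∑ p, K m x.1 i * (L n x.2 p * X (i, p) (j, q) * star (L n y.2 q)) *
        star (K m y.1 j) := Finset.sum_congr rfl fun j _ => Finset.sum_comm
    _ = ∑ n, ∑ j, ∑ i, ∑ q, ∑ p, K m x.1 i * (L n x.2 p * X (i, p) (j, q) * star (L n y.2 q)) *
        star (K m y.1 j) := Finset.sum_comm
    _ = ∑ n, ∑ j, ∑ q, ∑ i, ∑ p, K m x.1 i * (L n x.2 p * X (i, p) (j, q) * star (L n y.2 q)) *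
        star (K m y.1 j) :=
      Finset.sum_congr rfl fun n _ => Finset.sum_congr rfl fun j _ => Finset.sum_comm
    _ = _ := by
      refine Finset.sum_congr rfl fun n _ => Finset.sum_congr rfl fun j _ =>
        Finset.sum_congr rfl fun q _ => Finset.sum_congr rfl fun i _ =>
        Finset.sum_congr rfl fun p _ => ?_
      ring

end Kraus

/-! ### Fidelity with a state supported on the range of an isometry -/

section Fidelity

variable {m n : Type*} [Fintype m] [DecidableEq m] [Fintype n] [DecidableEq n]

omit [DecidableEq m] in
lemma posSemidef_one_sub_mul_conjTranspose {X : Matrix n m ℂ} (hX : X * Xᴴ * X = X) :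
    (1 - X * Xᴴ).PosSemidef := by
  have h := posSemidef_conjTranspose_mul_self (1 - X * Xᴴ)
  convert h using 1
  have hXX : X * Xᴴ * (X * Xᴴ) = X * Xᴴ := by rw [← Matrix.mul_assoc, hX]
  simp only [conjTranspose_sub, conjTranspose_one, conjTranspose_mul, conjTranspose_conjTranspose,
    mul_sub, sub_mul, one_mul, mul_one, hXX]
  abel

/-- Write ρ = YᴴY, G = √γ, Q = WWᴴ and polar-decompose YG = BS, where S = √(GρG). As QG = G, Tr S is
the Hilbert–Schmidt product of QYᴴB with G. Cauchy–Schwarz with Tr G² = 1 and BBᴴ ≤ 1 bounds its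
square by Tr[YQYᴴ] = Tr[Qρ]. -/
lemma fidelity_le_re_trace {ρ : Matrix n n ℂ} (hρ : ρ.PosSemidef) {W : Matrix n m ℂ}
    (hW : Wᴴ * W = 1) {τ : Matrix m m ℂ} (hτ : IsState τ) :
    fidelity ρ (W * τ * Wᴴ) ≤ ((W * Wᴴ) * ρ).trace.re := by
  have hγ : (W * τ * Wᴴ).PosSemidef := hτ.1.mul_mul_conjTranspose_same W
  have hγt : (W * τ * Wᴴ).trace = 1 := by
    rw [trace_mul_comm, ← Matrix.mul_assoc, hW, Matrix.one_mul, hτ.2]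
  have hWγ : (W * Wᴴ) * (W * τ * Wᴴ) = W * τ * Wᴴ := by
    calc _ = W * (Wᴴ * W) * τ * Wᴴ := by simp only [Matrix.mul_assoc]
      _ = _ := by rw [hW, Matrix.mul_one]
  rw [fidelity]
  generalize hγ' : W * τ * Wᴴ = γ at *
  set G := CFC.sqrt γ with hG
  have hGG : G * G = γ := CFC.sqrt_mul_sqrt_self γ hγ.nonneg
  have hGp : G.PosSemidef := nonneg_iff_posSemidef.mp (CFC.sqrt_nonneg γ)
  have hGs : Gᴴ = G := hGp.1
  set Q := W * Wᴴ with hQ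
  have hQs : Qᴴ = Q := by simp [hQ]
  have hQQ : Q * Q = Q := by
    calc _ = W * (Wᴴ * W) * Wᴴ := by simp only [hQ, Matrix.mul_assoc]
      _ = Q := by rw [hW, Matrix.mul_one]
  have hQG : Q * G = G := by
    have h0 : (G - Q * G) * (G - Q * G)ᴴ = 0 := by
      have h1 : γ * Q = γ := by
        have := congrArg conjTranspose hWγ
        rwa [conjTranspose_mul, hQs, hγ.1.eq] at this
      have h2 : Q * G * (G * Q) = γ := by
        rw [mul_assoc, ← mul_assoc G, hGG, h1, hWγ]
      have h3 : G * (G * Q) = γ := by rw [← mul_assoc, hGG, h1]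
      have h4 : Q * G * G = γ := by rw [mul_assoc, hGG, hWγ]
      simp only [conjTranspose_sub, conjTranspose_mul, hGs, hQs, mul_sub, sub_mul, h2, h3, h4, hGG]
      abel
    exact (sub_eq_zero.mp (self_mul_conjTranspose_eq_zero.mp h0)).symm
  obtain ⟨Y, rfl⟩ := exists_eq_conjTranspose_mul_self hρ
  have hM : (G * (Yᴴ * Y) * G).PosSemidef := by
    have := hρ.mul_mul_conjTranspose_same G
    rwa [hGs] at this
  set S := CFC.sqrt (G * (Yᴴ * Y) * G) with hS
  have hSS : S * S = G * (Yᴴ * Y) * G := CFC.sqrt_mul_sqrt_self _ hM.nonneg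
  have hSp : S.PosSemidef := nonneg_iff_posSemidef.mp (CFC.sqrt_nonneg _)
  -- S may be singular; its pseudoinverse makes B = YGP a partial isometry.
  obtain ⟨P, hPs, hSPS, hPSP, hcomm⟩ := exists_pseudoinverse hSp.1
  set B := Y * G * P with hB
  have hBB : Bᴴ * (Y * G) = S := by
    calc _ = P * (G * (Yᴴ * Y) * G) := by
          simp only [hB, conjTranspose_mul, hGs, hPs.eq, mul_assoc]
      _ = S := by rw [← hSS, ← mul_assoc, hcomm, hSPS]
  have hBBB : B * Bᴴ * B = B := by
    calc _ = Y * G * (P * (Bᴴ * (Y * G) * P)) := by rw [hB]; simp only [mul_assoc]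
      _ = B := by rw [hBB, ← mul_assoc P, hPSP]
  have htr : S.trace = ((Q * (Yᴴ * B))ᴴ * G).trace := by
    rw [← hBB]
    conv_lhs => rw [← hQG]
    simp only [conjTranspose_mul, hQs, conjTranspose_conjTranspose, mul_assoc]
  rw [htr]
  refine (re_trace_conjTranspose_mul_sq_le _ _).trans ?_
  rw [hGs, hGG, hγt, Complex.one_re, mul_one]
  have h1 : ((Q * (Yᴴ * B))ᴴ * (Q * (Yᴴ * B))).trace = ((B * Bᴴ) * (Y * Q * Yᴴ)).trace := by
    calc _ = (Bᴴ * (Y * (Q * Q) * Yᴴ * B)).trace := by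
          simp only [conjTranspose_mul, hQs, conjTranspose_conjTranspose, mul_assoc]
      _ = _ := by
        rw [hQQ, trace_mul_comm, mul_assoc, trace_mul_comm]
  have h2 : (Q * (Yᴴ * Y)).trace = (Y * Q * Yᴴ).trace := by
    rw [← mul_assoc, trace_mul_comm, ← mul_assoc]
  rw [h1, h2]
  refine re_trace_mul_le (le_iff.mpr (posSemidef_one_sub_mul_conjTranspose hBBB)) ?_
  have hq : (Y * Q * Yᴴ).PosSemidef := by
    have := posSemidef_self_mul_conjTranspose (Y * W)
    rwa [conjTranspose_mul, Matrix.mul_assoc, ← Matrix.mul_assoc W, ← Matrix.mul_assoc] at this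
  exact hq.nonneg

end Fidelity

/-! ### Private states as supports of privacy tests -/

section PrivateState

variable {d : ℕ} {S T : Type*} [Fintype S] [DecidableEq S] [Fintype T] [DecidableEq T]

/-- The isometry `V (∑ₐ |aa⟩/√d ⊗ I)` onto the range of the privacy test. -/
noncomputable def keyIsometry (U : Fin d → Matrix (S × T) (S × T) ℂ) :
    Matrix ((Fin d × Fin d) × (S × T)) (S × T) ℂ :=
  of fun x q => if x.1.1 = x.1.2 then (((√d)⁻¹ : ℝ) : ℂ) * U x.1.1 x.2 q else 0

omit [Fintype S] [DecidableEq S] [Fintype T] [DecidableEq T] in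
lemma keyIsometry_apply (U : Fin d → Matrix (S × T) (S × T) ℂ) (a a' : Fin d) (p q : S × T) :
    keyIsometry U ((a, a'), p) q = if a = a' then (((√d)⁻¹ : ℝ) : ℂ) * U a p q else 0 :=
  rfl

lemma ofReal_inv_sqrt_mul_self (d : ℕ) :
    (((√d)⁻¹ : ℝ) : ℂ) * (((√d)⁻¹ : ℝ) : ℂ) = (d : ℂ)⁻¹ := by
  rw [← Complex.ofReal_mul, ← mul_inv, Real.mul_self_sqrt (Nat.cast_nonneg d)]
  push_cast
  rfl

omit [DecidableEq S] [DecidableEq T] in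
lemma keyTest_eq (U : Fin d → Matrix (S × T) (S × T) ℂ) :
    keyTest U = keyIsometry U * (keyIsometry U)ᴴ := by
  ext ⟨⟨a, a'⟩, p⟩ ⟨⟨b, b'⟩, q⟩
  have hL : keyTest U ((a, a'), p) ((b, b'), q) =
      if a = a' ∧ b = b' then (d : ℂ)⁻¹ * (U a * (U b)ᴴ) p q else 0 := by
    simp only [keyTest, Matrix.smul_apply, Matrix.sum_apply, kroneckerMap_apply, smul_eq_mul,
      single_apply, ite_and, ite_mul, mul_ite, mul_one, one_mul, mul_zero, zero_mul]
    rcases eq_or_ne a a' with rfl | h <;> rcases eq_or_ne b b' with rfl | h' <;>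
      simp [*, Ne.symm]
  rw [hL]
  by_cases h : a = a' <;> by_cases h' : b = b'
  · simp only [keyIsometry_apply, h, h', and_self, if_true, mul_apply, Finset.mul_sum, conjTranspose_apply, star_mul',
      RCLike.star_def, Complex.conj_ofReal, ← ofReal_inv_sqrt_mul_self]
    exact Finset.sum_congr rfl fun r _ => by ring
  all_goals simp [mul_apply, keyIsometry_apply, h, h']

lemma keyIsometry_conjTranspose_mul_self (hd : 0 < d) {U : Fin d → Matrix (S × T) (S × T) ℂ}
    (hU : ∀ a, star (U a) * U a = 1) : (keyIsometry U)ᴴ * keyIsometry U = 1 := by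
  ext p q
  have h : ∀ a, ∑ r, star (U a r p) * U a r q = (1 : Matrix (S × T) (S × T) ℂ) p q := fun a => by
    rw [← hU a, mul_apply]
    rfl
  have hd' : (d : ℂ) ≠ 0 := by exact_mod_cast hd.ne'
  have h' : ∀ a, ∑ r, star ((((√d)⁻¹ : ℝ) : ℂ) * U a r p) * ((((√d)⁻¹ : ℝ) : ℂ) * U a r q) =
      (d : ℂ)⁻¹ * (1 : Matrix (S × T) (S × T) ℂ) p q := fun a => by
    rw [← h a, Finset.mul_sum, ← ofReal_inv_sqrt_mul_self]
    refine Finset.sum_congr rfl fun r _ => ?_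
    rw [star_mul', RCLike.star_def, Complex.conj_ofReal]
    ring
  calc _ = ∑ a : Fin d, ∑ r, star ((((√d)⁻¹ : ℝ) : ℂ) * U a r p) *
        ((((√d)⁻¹ : ℝ) : ℂ) * U a r q) := by
        rw [mul_apply]
        simp only [Fintype.sum_prod_type (α₁ := Fin d × Fin d), Fintype.sum_prod_type (α₁ := Fin d),
          keyIsometry, conjTranspose_apply, of_apply]
        refine Finset.sum_congr rfl fun a _ => ?_
        rw [Finset.sum_eq_single a]
        · simp
        · intro b _ hb
          simp [hb.symm]
        · simp
    _ = _ := by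
      simp only [h', Finset.sum_const, Finset.card_univ, Fintype.card_fin, nsmul_eq_mul]
      rw [← mul_assoc, mul_inv_cancel₀ hd', one_mul]

/-- V carries the isometry of the untwisted key to that of the twisted one. The private state thus
has the form WτWᴴ required by `fidelity_le_re_trace`, with WWᴴ the privacy test. -/
lemma twist_conj_eq (U : Fin d → unitaryGroup (S × T) ℂ) (τ : Matrix (S × T) (S × T) ℂ) :
    twist U * (maxEntangled d ⊗ₖ τ) * (twist U)ᴴ =
      keyIsometry (fun a => (U a : Matrix (S × T) (S × T) ℂ)) * τ *
        (keyIsometry fun a => (U a : Matrix (S × T) (S × T) ℂ))ᴴ := by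
  have hΦ : maxEntangled d ⊗ₖ τ = keyIsometry (fun _ : Fin d => (1 : Matrix (S × T) (S × T) ℂ)) *
      τ * (keyIsometry fun _ : Fin d => (1 : Matrix (S × T) (S × T) ℂ))ᴴ := by
    ext ⟨⟨a, a'⟩, p⟩ ⟨⟨b, b'⟩, q⟩
    have hL : maxEntangled d (a, a') (b, b') = if a = a' ∧ b = b' then (d : ℂ)⁻¹ else 0 := by
      simp only [maxEntangled, Matrix.smul_apply, Matrix.sum_apply, kroneckerMap_apply, smul_eq_mul,
        single_apply, ite_and, mul_ite, mul_one, mul_zero, one_div]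
      rcases eq_or_ne a a' with rfl | h <;> rcases eq_or_ne b b' with rfl | h' <;>
        simp [*, Ne.symm]
    rw [kroneckerMap_apply, hL]
    by_cases h : a = a' <;> by_cases h' : b = b'
    · rw [if_pos ⟨h, h'⟩, ← ofReal_inv_sqrt_mul_self]
      simp only [mul_apply, keyIsometry_apply, h, h', if_true, one_apply, conjTranspose_apply,
        mul_one, mul_zero, ite_mul, zero_mul, Finset.sum_ite_eq, Finset.mem_univ, apply_ite,
        star_zero, RCLike.star_def, Complex.conj_ofReal]
      ring
    all_goals simp [mul_apply, keyIsometry_apply, h, h']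
  have hV : twist U * keyIsometry (fun _ : Fin d => (1 : Matrix (S × T) (S × T) ℂ)) =
      keyIsometry fun a => (U a : Matrix (S × T) (S × T) ℂ) := by
    have ht : ∀ x y, twist U x y = if x.1 = y.1 then
        (U x.1.2 : Matrix (S × T) (S × T) ℂ) x.2 y.2 else 0 := fun x y => by
      simp only [twist, Matrix.sum_apply, kroneckerMap_apply, one_apply, single_apply, ite_and,
        ite_mul, mul_ite, mul_one, one_mul, mul_zero, zero_mul, Prod.ext_iff]
      split_ifs <;> simp_all
    ext ⟨⟨a, a'⟩, p⟩ q
    simp only [mul_apply, ht, Fintype.sum_prod_type (α₁ := Fin d × Fin d), ite_mul, zero_mul,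
      keyIsometry, of_apply]
    rw [Finset.sum_eq_single (a, a')]
    · by_cases h : a = a'
      · simp [h, one_apply, mul_comm]
      · simp [h]
    · intro b _ hb
      simp [hb.symm]
    · simp
  rw [hΦ, ← hV]
  simp only [conjTranspose_mul, Matrix.mul_assoc]

omit [DecidableEq S] [DecidableEq T] in
lemma trace_keyTest_mul_regroup (U : Fin d → Matrix (S × T) (S × T) ℂ)
    (X : Matrix ((Fin d × S) × (Fin d × T)) ((Fin d × S) × (Fin d × T)) ℂ) :
    (keyTest U * regroup X).trace = (privacyTest U * X).trace := by
  rw [← trace_submatrix_equiv _ (Equiv.prodProdProdComm (Fin d) S (Fin d) T),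
    ← submatrix_mul_equiv _ _ _ (Equiv.prodProdProdComm (Fin d) S (Fin d) T)]
  rfl

omit [DecidableEq S] [DecidableEq T] in
lemma posSemidef_privacyTest (U : Fin d → Matrix (S × T) (S × T) ℂ) :
    (privacyTest U).PosSemidef := by
  rw [privacyTest, keyTest_eq]
  exact (posSemidef_self_mul_conjTranspose _).submatrix _

lemma posSemidef_one_sub_privacyTest (hd : 0 < d) {U : Fin d → Matrix (S × T) (S × T) ℂ}
    (hU : ∀ a, star (U a) * U a = 1) : (1 - privacyTest U).PosSemidef := by
  have h : (1 - keyTest U).PosSemidef := by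
    rw [keyTest_eq]
    refine posSemidef_one_sub_mul_conjTranspose ?_
    rw [Matrix.mul_assoc, keyIsometry_conjTranspose_mul_self hd hU, Matrix.mul_one]
  have := h.submatrix (Equiv.prodProdProdComm (Fin d) S (Fin d) T)
  rwa [submatrix_sub, Pi.sub_apply, Pi.sub_apply, submatrix_one_equiv] at this

end PrivateState

/-! ### Stinespring dilations -/

section Stack

variable {d : ℕ} {S T A B N : Type*} [Fintype S] [DecidableEq S] [Fintype T] [DecidableEq T]
  [Fintype A] [DecidableEq A] [Fintype B] [DecidableEq B] [Fintype N] [DecidableEq N]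

/-- The isometry obtained by stacking Kraus operators, with the environment joined to the shield. -/
def stack {D : Type*} (F : N → Matrix (D × T) B ℂ) : Matrix (D × (T × N)) B ℂ :=
  of fun y b => F y.2.2 (y.1, y.2.1) b

omit [DecidableEq T] [Fintype B] [DecidableEq B] [DecidableEq N] in
lemma stack_conjTranspose_mul_self {D : Type*} [Fintype D] (F : N → Matrix (D × T) B ℂ) :
    (stack F)ᴴ * stack F = ∑ n, (F n)ᴴ * F n := by
  ext b b'
  simp only [mul_apply, Matrix.sum_apply, conjTranspose_apply, stack, of_apply,
    Fintype.sum_prod_type]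
  calc _ = ∑ p, ∑ n, ∑ t, star (F n (p, t) b) * F n (p, t) b' :=
        Finset.sum_congr rfl fun p _ => Finset.sum_comm
    _ = _ := Finset.sum_comm

/-- Extension of shield unitaries by the identity on an environment. -/
def extendShield (N : Type*) [DecidableEq N] (U : Fin d → Matrix (S × T) (S × T) ℂ) (a : Fin d) :
    Matrix (S × (T × N)) (S × (T × N)) ℂ :=
  (U a ⊗ₖ (1 : Matrix N N ℂ)).submatrix (Equiv.prodAssoc S T N).symm (Equiv.prodAssoc S T N).symm

omit [DecidableEq S] [DecidableEq T] in
lemma extendShield_mul_star (U U' : Fin d → Matrix (S × T) (S × T) ℂ) (a b : Fin d) :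
    extendShield N U a * (extendShield N U' b)ᴴ =
      ((U a * (U' b)ᴴ) ⊗ₖ (1 : Matrix N N ℂ)).submatrix
        (Equiv.prodAssoc S T N).symm (Equiv.prodAssoc S T N).symm := by
  rw [extendShield, extendShield, conjTranspose_submatrix, submatrix_mul_equiv,
    conjTranspose_kronecker, conjTranspose_one, ← mul_kronecker_mul, Matrix.one_mul]

lemma extendShield_unitary {U : Fin d → Matrix (S × T) (S × T) ℂ}
    (hU : ∀ a, U a * star (U a) = 1) (a : Fin d) :
    extendShield N U a * star (extendShield N U a) = 1 := by
  rw [star_eq_conjTranspose, extendShield_mul_star, ← star_eq_conjTranspose, hU,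
    one_kronecker_one, submatrix_one_equiv]

omit [DecidableEq S] [DecidableEq T] in
lemma privacyTest_extendShield (U : Fin d → Matrix (S × T) (S × T) ℂ)
    (x y : (Fin d × S) × (Fin d × (T × N))) :
    privacyTest (extendShield N U) x y = if x.2.2.2 = y.2.2.2 then
      privacyTest U (x.1, (x.2.1, x.2.2.1)) (y.1, (y.2.1, y.2.2.1)) else 0 := by
  simp only [privacyTest, keyTest, extendShield_mul_star, submatrix_apply, Matrix.smul_apply,
    Matrix.sum_apply, kroneckerMap_apply, one_apply, Equiv.prodProdProdComm_apply,
    Equiv.prodAssoc_symm_apply]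
  split_ifs <;> simp

omit [Fintype A] [DecidableEq A] [Fintype B] [DecidableEq B] in
omit [DecidableEq S] [DecidableEq T] in
-- The extended test is the identity on the environment, so conjugation by the stacked isometry sums
-- over its index and returns Bob's Kraus operators.
lemma conj_stack_privacyTest (U : Fin d → Matrix (S × T) (S × T) ℂ) (E : Matrix (Fin d × S) A ℂ)
    (F : N → Matrix (Fin d × T) B ℂ) :
    (E ⊗ₖ stack F)ᴴ * privacyTest (extendShield N U) * (E ⊗ₖ stack F) =
      ∑ n, (E ⊗ₖ F n)ᴴ * privacyTest U * (E ⊗ₖ F n) := by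
  let r : (Fin d × S) × (Fin d × (T × N)) ≃ ((Fin d × S) × (Fin d × T)) × N :=
    ((Equiv.refl _).prodCongr (Equiv.prodAssoc _ _ _).symm).trans (Equiv.prodAssoc _ _ _).symm
  have h1 : privacyTest (extendShield N U) =
      (privacyTest U ⊗ₖ (1 : Matrix N N ℂ)).submatrix r r := by
    ext x y
    rw [privacyTest_extendShield]
    simp [r, kroneckerMap_apply, one_apply]
  let Z : Matrix (((Fin d × S) × (Fin d × T)) × N) (A × B) ℂ := of fun x => (E ⊗ₖ F x.2) x.1
  have h2 : E ⊗ₖ stack F = Z.submatrix r id := by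
    ext x y
    simp [Z, r, kroneckerMap_apply, stack]
  rw [h1, h2, conjTranspose_submatrix, submatrix_mul_equiv, submatrix_mul_equiv, submatrix_id_id]
  ext x y
  simp only [mul_apply, Matrix.sum_apply, Fintype.sum_prod_type (α₂ := N), kroneckerMap_apply,
    one_apply, mul_ite, mul_one, mul_zero, Finset.sum_ite_eq', Finset.mem_univ,
    if_true, conjTranspose_apply, Z, of_apply]
  exact Finset.sum_comm

/-- Bounds on the local copies of an operator survive local isometric dilations. -/
lemma posSemidef_sub_sum_localOp_conj {ι A' C : Type*} [Fintype ι] [Fintype A'] [DecidableEq A']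
    [Fintype C] [DecidableEq C] {k : ℕ} {E : ι → Matrix A' A ℂ} {V : ι → Matrix C B ℂ}
    (hE : ∑ x, (E x)ᴴ * E x = 1) (hV : ∀ x, (V x)ᴴ * V x = 1) {P : Matrix (A' × C) (A' × C) ℂ}
    {c : ℂ} (h : (c • 1 - ∑ i : Fin k, localOp i P).PosSemidef) :
    (c • 1 - ∑ i : Fin k, localOp i (∑ x, (E x ⊗ₖ V x)ᴴ * P * (E x ⊗ₖ V x))).PosSemidef := by
  -- Alice's operator acts once, while every extension applies the isometry for the same message x;
  -- one-way communication makes this possible.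
  let G : ι → Matrix (A' × (Fin k → C)) (A × (Fin k → B)) ℂ :=
    fun x => E x ⊗ₖ tensorPow (Fin k) (V x)
  have hG : ∑ x, (G x)ᴴ * G x = 1 := by
    have : ∀ x, (G x)ᴴ * G x = ((E x)ᴴ * E x) ⊗ₖ (1 : Matrix (Fin k → B) (Fin k → B) ℂ) :=
      fun x => by
        rw [conjTranspose_kronecker, ← mul_kronecker_mul, tensorPow_conjTranspose_mul_self _ (hV x)]
    simp only [this]
    rw [← one_kronecker_one (α := ℂ) (m := A) (n := Fin k → B), ← hE]
    ext
    simp only [Matrix.sum_apply, kroneckerMap_apply, Finset.sum_mul]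
  have hsum := posSemidef_sum Finset.univ fun x (_ : x ∈ Finset.univ) =>
    h.conjTranspose_mul_mul_same (G x)
  convert hsum using 1
  simp only [Matrix.mul_sub, Matrix.sub_mul, Finset.sum_sub_distrib, Matrix.mul_smul,
    Matrix.smul_mul, Matrix.mul_one, ← Finset.smul_sum, hG, Matrix.mul_sum, Matrix.sum_mul]
  congr 1
  rw [Finset.sum_comm]
  refine Finset.sum_congr rfl fun i _ => ?_
  rw [localOp_sum]
  exact Finset.sum_congr rfl fun x _ => (conj_localOp i (E x) (hV x) P).symm

/-- Privacy tests on `k` extensions, after local measurements of Alice and channels of Bob. -/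
lemma posSemidef_sub_sum_localOp_kraus {ι : Type*} [Fintype ι] {k : ℕ} (hk : 0 < k) (hd : 0 < d)
    {U : Fin d → Matrix (S × T) (S × T) ℂ} (hU : ∀ a, U a * star (U a) = 1)
    {E : ι → Matrix (Fin d × S) A ℂ} {F : ι → N → Matrix (Fin d × T) B ℂ}
    (hE : ∑ x, (E x)ᴴ * E x = 1) (hF : ∀ x, ∑ n, (F x n)ᴴ * F x n = 1) :
    (((1 + (k - 1) * (d : ℝ)⁻¹ : ℝ) : ℂ) • 1 - ∑ i : Fin k, localOp i
      (∑ x, ∑ n, (E x ⊗ₖ F x n)ᴴ * privacyTest U * (E x ⊗ₖ F x n))).PosSemidef := by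
  -- With Bob's environment counted as part of his shield, the dilated test is again a privacy test,
  -- with unitaries extended by the identity.
  have hunit := extendShield_unitary (N := N) hU
  have h := posSemidef_sub_sum_localOp_conj (E := E) (V := fun x => stack (F x)) hE
    (fun x => (stack_conjTranspose_mul_self (F x)).trans (hF x))
    (posSemidef_sub_sum_localOp_privacyTest hk hd (fun a => mul_eq_one_comm.mp (hunit a)) hunit)
  simpa only [conj_stack_privacyTest] using h

end Stack

/-! ### The bound on distillable key -/

section Bound

variable {A B : Type*} [Fintype A] [DecidableEq A] [Fintype B] [DecidableEq B]

/-- A distillation protocol, followed by the privacy test, is a good test of `ρ` that is passed by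
extendible states with small probability only. -/
lemma Distillable.exists_test {ρ : Matrix (A × B) (A × B) ℂ} (hρ : IsState ρ) {ε : ℝ} {d k : ℕ}
    (hd : 0 < d) (hk : 0 < k) (h : Distillable ρ ε d) :
    ∃ Λ : Matrix (A × B) (A × B) ℂ, 0 ≤ Λ ∧ Λ ≤ 1 ∧ 1 - ε ≤ (Λ * ρ).trace.re ∧
      ∀ σ ∈ (Ext k : Set (Matrix (A × B) (A × B) ℂ)),
        k * (Λ * σ).trace.re ≤ 1 + (k - 1) * (d : ℝ)⁻¹ := by
  obtain ⟨s, t, γ, 𝓛, ⟨U, τ, hτ, rfl⟩, ⟨N, 𝓔, 𝓕, h𝓔, hTP, h𝓕, rfl⟩, hF⟩ := h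
  choose E hE using fun x => (h𝓔 x).exists_kraus
  choose F hFK using fun x => (h𝓕 x).1.exists_kraus
  let u : Fin d → Matrix (Fin s × Fin t) (Fin s × Fin t) ℂ := fun a => U a
  have hu : ∀ a, star (u a) * u a = 1 := fun a => (U a).2.1
  have hu' : ∀ a, u a * star (u a) = 1 := fun a => (U a).2.2
  let P := privacyTest u
  -- The message and Alice's Kraus index are merged into one index m; Bob's channel depends on the
  -- message m.1 alone.
  have hE1 : ∑ m : Fin N × (A × (Fin d × Fin s)), (E m.1 m.2)ᴴ * E m.1 m.2 = 1 := by
    refine sum_conjTranspose_mul_self_eq_one fun X => ?_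
    rw [← hTP.2 X, Fintype.sum_prod_type]
    simp only [LinearMap.sum_apply, hE]
  have hF1 : ∀ x, ∑ n, (F x n)ᴴ * F x n = 1 := fun x =>
    sum_conjTranspose_mul_self_eq_one fun X => by rw [← hFK, (h𝓕 x).2]
  let K : Fin N × (A × (Fin d × Fin s)) → B × (Fin d × Fin t) →
      Matrix ((Fin d × Fin s) × (Fin d × Fin t)) (A × B) ℂ := fun m n => E m.1 m.2 ⊗ₖ F m.1 n
  have h𝓛 : ∀ X, (∑ x, tensorMap (𝓔 x) (𝓕 x)) X = ∑ m, ∑ n, K m n * X * (K m n)ᴴ := fun X => by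
    rw [LinearMap.sum_apply, Fintype.sum_prod_type]
    exact Finset.sum_congr rfl fun x _ => tensorMap_kraus (hE x) (hFK x) X
  have hK1 : ∑ m, ∑ n, (K m n)ᴴ * K m n = 1 := by
    have : ∀ m, ∑ n, (K m n)ᴴ * K m n = ((E m.1 m.2)ᴴ * E m.1 m.2) ⊗ₖ (1 : Matrix B B ℂ) :=
      fun m => by
        rw [← hF1 m.1]
        simp only [K, conjTranspose_kronecker, ← mul_kronecker_mul]
        ext
        simp only [Matrix.sum_apply, kroneckerMap_apply, Finset.mul_sum]
    simp only [this]
    rw [← one_kronecker_one (α := ℂ) (m := A) (n := B), ← hE1]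
    ext
    simp only [Matrix.sum_apply, kroneckerMap_apply, Finset.sum_mul]
  -- The privacy test in the Heisenberg picture.
  let Λ : Matrix (A × B) (A × B) ℂ := ∑ m, ∑ n, (K m n)ᴴ * P * K m n
  have hΛtr : ∀ X, (Λ * X).trace = (P * (∑ x, tensorMap (𝓔 x) (𝓕 x)) X).trace := fun X => by
    simp only [h𝓛, Λ, Matrix.sum_mul, Matrix.mul_sum, trace_sum]
    refine Finset.sum_congr rfl fun m _ => Finset.sum_congr rfl fun n _ => ?_
    rw [Matrix.mul_assoc, Matrix.mul_assoc, trace_mul_comm]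
    simp only [Matrix.mul_assoc]
  have hP := posSemidef_privacyTest u
  refine ⟨Λ, ?_, ?_, ?_, fun σ hσ => ?_⟩
  · exact (posSemidef_sum _ fun m _ => posSemidef_sum _ fun n _ =>
      hP.conjTranspose_mul_mul_same _).nonneg
  · rw [le_iff]
    have := posSemidef_sum Finset.univ fun m (_ : m ∈ Finset.univ) =>
      posSemidef_sum Finset.univ fun n (_ : n ∈ Finset.univ) =>
        (posSemidef_one_sub_privacyTest hd hu).conjTranspose_mul_mul_same (K m n)
    simpa only [Matrix.mul_sub, Matrix.sub_mul, Matrix.mul_one, Finset.sum_sub_distrib, hK1]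
      using this
  · rw [twist_conj_eq] at hF
    refine hF.trans ?_
    rw [hΛtr, ← trace_keyTest_mul_regroup, keyTest_eq]
    refine fidelity_le_re_trace (PosSemidef.submatrix ?_ _)
      (keyIsometry_conjTranspose_mul_self hd hu) hτ
    rw [h𝓛]
    exact posSemidef_sum _ fun m _ => posSemidef_sum _ fun n _ =>
      hρ.1.mul_mul_conjTranspose_same _
  · obtain ⟨ω, hω, hωt, hωp, rfl⟩ := (mem_Ext_iff hk).mp hσ
    have hbound := posSemidef_sub_sum_localOp_kraus (S := Fin s) (T := Fin t)
      (ι := Fin N × (A × (Fin d × Fin s))) (N := B × (Fin d × Fin t)) (U := u)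
      (E := fun m => E m.1 m.2) (F := fun m => F m.1) hk hd hu' hE1 fun m => hF1 m.1
    change (_ - ∑ i : Fin k, localOp i Λ).PosSemidef at hbound
    -- Pairing the operator bound with ω, each of the k local terms equals Tr[Λσ] by permutation
    -- invariance.
    have := re_trace_mul_nonneg hbound hω
    rw [Matrix.sub_mul, Matrix.smul_mul, Matrix.one_mul, Matrix.sum_mul, trace_sub, trace_smul,
      trace_sum, hωt, Complex.sub_re] at this
    simp only [hωp.trace_localOp_mul _ ⟨0, hk⟩, ← trace_mul_marginal, Finset.sum_const,
      Finset.card_univ, Fintype.card_fin, nsmul_eq_mul, smul_eq_mul, mul_one, Complex.ofReal_re]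
      at this
    rw [← Complex.ofReal_natCast, Complex.re_ofReal_mul] at this
    linarith

end Bound

/-! ### Base-two logarithms -/

section Log2

lemma log2_ofReal {r : ℝ} (hr : 0 < r) :
    log2 (ENNReal.ofReal r) = ((Real.log r / Real.log 2 : ℝ) : EReal) := by
  rw [log2, ENNReal.log_ofReal_of_pos hr, EReal.coe_div]

lemma log2_zero : log2 0 = ⊥ := by
  rw [log2, ENNReal.log_zero, EReal.bot_div_of_pos_ne_top _ (EReal.coe_ne_top _)]
  exact_mod_cast Real.log_pos one_lt_two

lemma exp2_log2 (x : ℝ≥0∞) : exp2 (log2 x) = x := by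
  have h : Real.log 2 ≠ 0 := (Real.log_pos one_lt_two).ne'
  rw [exp2, log2, EReal.div_mul_cancel (EReal.coe_ne_bot _) (EReal.coe_ne_top _)
    (by exact_mod_cast h), ENNReal.exp_log]

/-- Multiplied by d/k, the hypothesis reads d(v - 1/k) ≤ (k-1)/k. -/
lemma log2_natCast_le {d k : ℕ} (hd : 0 < d) (hk : 2 ≤ k) {v : ℝ}
    (hv : k * v ≤ 1 + (k - 1) * (d : ℝ)⁻¹) :
    log2 (d : ℝ≥0∞) ≤ log2 (((k : ℝ≥0∞) - 1) / (k : ℝ≥0∞)) -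
      log2 (ENNReal.ofReal v - 1 / (k : ℝ≥0∞)) := by
  have hk0 : (0 : ℝ) < k := by positivity
  have hk1 : (0 : ℝ) < (k : ℝ) - 1 := by
    have : (2 : ℝ) ≤ k := by exact_mod_cast hk
    linarith
  have hd0 : (0 : ℝ) < d := by positivity
  have e1 : ((k : ℝ≥0∞) - 1) / (k : ℝ≥0∞) = ENNReal.ofReal ((k - 1) / k) := by
    rw [ENNReal.ofReal_div_of_pos hk0, ENNReal.ofReal_sub _ zero_le_one, ENNReal.ofReal_natCast,
      ENNReal.ofReal_one]
  have e2 : 1 / (k : ℝ≥0∞) = ENNReal.ofReal (1 / k) := by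
    rw [ENNReal.ofReal_div_of_pos hk0, ENNReal.ofReal_natCast, ENNReal.ofReal_one]
  rw [e1, e2, ← ENNReal.ofReal_sub _ (by positivity), ← ENNReal.ofReal_natCast d, log2_ofReal hd0,
    log2_ofReal (div_pos hk1 hk0)]
  rcases le_or_gt (v - 1 / k) 0 with h | h
  -- For v ≤ 1/k the truncated difference is 0, its logarithm is ⊥, and the bound is ⊤.
  · rw [ENNReal.ofReal_of_nonpos h, log2_zero, EReal.coe_sub_bot]
    exact le_top
  · rw [log2_ofReal h, ← EReal.coe_sub, EReal.coe_le_coe_iff, ← sub_div,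
      ← Real.log_div (div_pos hk1 hk0).ne' h.ne']
    refine div_le_div_of_nonneg_right (Real.log_le_log hd0 ?_) (Real.log_pos one_lt_two).le
    rw [le_div_iff₀ h, le_div_iff₀ hk0]
    have h2 := mul_le_mul_of_nonneg_left hv hd0.le
    have e3 : (d : ℝ) * (1 + (k - 1) * (d : ℝ)⁻¹) = d + (k - 1) := by field_simp
    have e4 : (d : ℝ) * (v - 1 / k) * k = d * (k * v) - d := by field_simp
    linarith

end Log2

end OneWayKey

/-! ### Conclusion: the key bound and the semidefinite program -/

theorem mainTheorem2 {A B : Type*} [Fintype A] [DecidableEq A] [Fintype B] [DecidableEq B]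
    (k : ℕ) (hk : 2 ≤ k) (ε : ℝ) (hε : ε ∈ Set.Icc (0 : ℝ) 1)
    (ρ : Matrix (A × B) (A × B) ℂ) (hρ : OneWayKey.IsState ρ) :
    (OneWayKey.unextDivergence k ε ρ ≤ OneWayKey.log2 (k : ℝ≥0∞) →
      OneWayKey.distillableKey ρ ε ≤
        OneWayKey.log2 (((k : ℝ≥0∞) - 1) / (k : ℝ≥0∞)) -
          OneWayKey.log2
            (OneWayKey.exp2 (-OneWayKey.unextDivergence k ε ρ) - 1 / (k : ℝ≥0∞))) ∧
    ∃ v : ℝ, IsLUB (OneWayKey.sdpValues k ε ρ) v ∧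
      (0 < ε → v ∈ OneWayKey.sdpValues k ε ρ) ∧
      OneWayKey.unextDivergence k ε ρ = -OneWayKey.log2 (ENNReal.ofReal v) := by
  refine ⟨fun _ => ?_, OneWayKey.unextDivergence_sdp (by omega) hε.1 hρ⟩
  -- One optimal σ serves all d: every test at level 1 - ε accepts it with probability at least v,
  -- whereas the test from a protocol obeys the monogamy bound.
  obtain ⟨v, -, hE, ⟨σ, hσ, hv⟩, -⟩ :=
    OneWayKey.exists_unextDivergence_eq (k := k) (by omega) hε.1 hρ
  rw [hE, neg_neg, OneWayKey.exp2_log2]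
  refine iSup₂_le fun d hd => ?_
  obtain ⟨Λ, h0, h1, h2, h3⟩ := hd.2.exists_test (k := k) hρ hd.1 (by omega)
  refine OneWayKey.log2_natCast_le hd.1 hk (le_trans ?_ (h3 σ hσ))
  exact mul_le_mul_of_nonneg_left (hv Λ h0 h1 h2) (Nat.cast_nonneg k)
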